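/- Let $\mathbf k=(k_1,\dots,k_r)$ be a composition, i.e. a finite sequence of $r\ge 1$ positive integers, with weight $w=k_1+\cdots+k_r$. For $|x|<1$ put $$\mathrm{Li}_{\mathbf k}(x)=\sum_{n_1>\cdots>n_r>0}\frac{x^{n_1}}{n_1^{k_1}\cdots n_r^{k_r}},$$ and for real $x<1$ let $\mathrm{Li}_{\mathbf k}(x)$ denote the analytic continuation of this function along $(-\infty,1)$. Write $\overleftarrow{\mathbf k}=(k_r,\dots,k_1)$ and $\mathbf k_+=(k_1+1,k_2,\dots,k_r)$. Let $\mathbf k^\vee=(k_1',\dots,k'_{r'})$ be the Hoffman dual of $\mathbf k$, i.e. the composition of $w$ whose set of proper partial sums $\{k_1'+\cdots+k_j' : 1\le j<r'\}$ is the complement in $\{1,\dots,w-1\}$ of $\{k_1+\cdots+k_j : 1\le j<r\}$. For a composition $\mathbf m=(m_1,\dots,m_p)$ with $m_1>1$ and $a\in\mathbb C\setminus\{0,-1,-2,\dots\}$ put $$\zeta^\star(\mathbf m;a)=\lim_{n\to\infty}\ \sum_{n\ge n_1\ge\cdots\ge n_p>0}\frac{1}{(n_1+a-1)^{m_1}\cdots(n_p+a-1)^{m_p}}.$$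 Then for every $\alpha\in\mathbb C$ with $\Re(\alpha)<1$ the following integral converges absolutely and $$\int_0^1\frac{\mathrm{Li}_{\mathbf k}\!\left(\frac{x}{x-1}\right)}{x(1-x)^{\alpha}}\,dx=(-1)^r\,\zeta^\star\!\left(\big(\overleftarrow{\mathbf k}^{\,\vee}\big)_+;\,1-\alpha\right).$$ Moreover, with $\mathbb N=\{1,2,3,\dots\}$, the limit defining the right-hand side exists for every $\alpha\in\mathbb C\setminus\mathbb N$, the left-hand side has a holomorphic continuation in $\alpha$ from $\{\Re(\alpha)<1\}$ to $\mathbb C\setminus\mathbb N$, and the identity holds for all $\alpha\in\mathbb C\setminus\mathbb N$ with the left-hand side understood as this continuation. -/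

import Mathlib

open Filter Topology MeasureTheory

noncomputable section

namespace HurwitzMZV

/-- The Hoffman dual of a composition `k` of `w`. Under `compositionEquiv` and
`compositionAsSetEquiv` a composition corresponds to the set of its proper partial sums
`k₁ + ⋯ + kⱼ` in `{1, …, w - 1}` (the element `i : Fin (w - 1)` stands for the number `i + 1`);
the dual is the composition whose set of proper partial sums is the complement. -/
def hoffmanDual {w : ℕ} (k : Composition w) : Composition w :=
  (compositionEquiv w).symm
    ((compositionAsSetEquiv w).symm (compositionAsSetEquiv w (compositionEquiv w k))ᶜ)

/-- `(k₁, k₂, …, k_r) ↦ (k₁ + 1, k₂, …, k_r)`. -/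
def plusFirst {r : ℕ} (k : Fin r → ℕ) : Fin r → ℕ :=
  fun i => if (i : ℕ) = 0 then k i + 1 else k i

/-- The multiple polylogarithm series in `r` variables,
`∑_{n₁ > ⋯ > n_r > 0} ∏ xᵢ ^ nᵢ / nᵢ ^ kᵢ`. -/
def mplSeries {r : ℕ} (k : Fin r → ℕ) (x : Fin r → ℝ) : ℝ :=
  ∑' n : {n : Fin r → ℕ // StrictAnti n ∧ ∀ i, 0 < n i},
    ∏ i, x i ^ (n.1 i) / (n.1 i : ℝ) ^ (k i)

/-- The single-variable series: `x₁ = x` and `x₂ = ⋯ = x_r = 1`. -/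
def mplSeries₁ {r : ℕ} (k : Fin r → ℕ) (x : ℝ) : ℝ :=
  mplSeries k (fun i => if (i : ℕ) = 0 then x else 1)

/-- `f` is an analytic continuation of the single-variable multiple polylogarithm series from
`(-1, 1)` to the real half-line `(-∞, 1)`. By the identity theorem two such functions agree on
`(-∞, 1)`. -/
def IsMPLContinuation {r : ℕ} (k : Fin r → ℕ) (f : ℝ → ℝ) : Prop :=
  AnalyticOnNhd ℝ f (Set.Iio 1) ∧ ∀ x ∈ Set.Ioo (-1 : ℝ) 1, f x = mplSeries₁ k x

open Classical in
/-- The single-variable multiple polylogarithm `Li_k(x)` for real `x < 1`: the analytic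
continuation of its series to `(-∞, 1)`. -/
def Li {r : ℕ} (k : Fin r → ℕ) (x : ℝ) : ℝ :=
  if h : ∃ f : ℝ → ℝ, IsMPLContinuation k f then h.choose x else 0

/-- The Hurwitz-type multiple harmonic star sum
`∑_{n ≥ n₁ ≥ ⋯ ≥ n_r > 0} ∏ 1 / (nᵢ + a - 1) ^ kᵢ`. -/
def zetaStarSum {r : ℕ} (k : Fin r → ℕ) (a : ℂ) (n : ℕ) : ℂ :=
  ∑ m ∈ (Fintype.piFinset fun _ : Fin r => Finset.Icc 1 n) with ∀ i j, i ≤ j → m j ≤ m i,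
    ∏ i, 1 / ((m i : ℂ) + a - 1) ^ (k i)

/-- The Hurwitz-type multiple zeta star value, the limit of the star sums. -/
def zetaStar {r : ℕ} (k : Fin r → ℕ) (a : ℂ) : ℂ :=
  limUnder atTop (zetaStarSum k a)

/-- `ℂ` without the positive integers. -/
def complexMinusPosInt : Set ℂ := {α : ℂ | ∀ n : ℕ, 0 < n → α ≠ n}

/-- The integrand `Li_k(x / (x - 1)) / (x (1 - x) ^ α)` on `0 < x < 1`. -/
def integrand {r : ℕ} (k : Fin r → ℕ) (α : ℂ) (x : ℝ) : ℂ :=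
  (Li k (x / (x - 1)) : ℂ) / ((x : ℂ) * ((1 - x : ℝ) : ℂ) ^ α)

end HurwitzMZV

end

noncomputable section

namespace HurwitzMZV

/-! ### Power series with bounded coefficients -/

/-! Encode the composition by a word, outermost form first, so that `Li` is an iterated integral
from 0 in the forms dt/t (`false`) and dt/(1 - t) (`true`), with r letters `true`. Under u = t/(t -
1) one has du/(1 - u) = -dt/(1 - t) and du/u = dt/(t(1 - t)). Hence Li_k(x/(x - 1)) = (-1)^r F(x),
where F is the iterated integral of the same word with dt/(t(1 - t)) in place of dt/t (`landen_aux`,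
`Li_div_sub_one`). F is a power series with bounded coefficients, so it is defined on all of (0, 1),
and this also supplies the continuation of Li to the negative half-line.

Let M_b(s) be the integral of F_b(x)(1 - x)^(s - 1) over (0, 1). Integration by parts, together with
1/x = ∑ (1 - x)^m, gives M_[](s) = 1/s, M_(true b)(s) = M_b(s)/s and M_(false b)(s) = (1/s) ∑_{m ≥
0} M_b(s + m) for nonempty b (`mellin_cons_true`, `mellin_cons_false`). The integral of the theorem
is (-1)^r ∑_{j ≥ 1} M_b(j - α). Unfolded, it is a nested sum over j₁ ≤ j₂ ≤ ⋯ of factors 1/(j - α):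
`true` repeats the current index and `false` passes to a new, larger or equal one. Cutting all
indices at N gives exactly a finite star sum (`sum_truncSum_eq`), and dominated convergence lets N
tend to infinity (`tendsto_sum_truncSum`).

The exponents are the run lengths between letters `false`, read from the innermost end, whereas the
parts of k are the run lengths between letters `true`. This complementarity is Hoffman duality, the
change of reading direction is the reversal, and the last factor 1/s from the empty word raises the
first exponent by one (`plusFirst_hoffmanDual_reverse`).

For the continuation, the star sums converge locally uniformly off the positive integers: the
leading exponent is at least 2 and the inner star sums are O(√m)
(`exists_differentiableOn_tendsto_starList`). Their limit is holomorphic and agrees with the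
integral for Re α < 1. -/

/-- The sum of the power series with coefficients `c`. -/
def pseries (c : ℕ → ℝ) (x : ℝ) : ℝ := ∑' n, c n * x ^ n

/-- Coefficients of `∫ f(t) dt / t`. -/
def opX (c : ℕ → ℝ) (n : ℕ) : ℝ := c n / n

/-- Coefficients of `∫ f(t) dt / (1 - t)`. -/
def opY (c : ℕ → ℝ) (n : ℕ) : ℝ := (∑ m ∈ Finset.range n, c m) / n

/-- Coefficients of `∫ f(t) dt / (t (1 - t))`. -/
def opZ (c : ℕ → ℝ) (n : ℕ) : ℝ := (∑ m ∈ Finset.range (n + 1), c m) / n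

-- Division by zero gives 0, so the constant coefficient vanishes, as it must for a primitive based
-- at 0; the same holds for the other two operators.
@[simp] lemma opX_zero (c : ℕ → ℝ) : opX c 0 = 0 := by simp [opX]
@[simp] lemma opY_zero (c : ℕ → ℝ) : opY c 0 = 0 := by simp [opY]
@[simp] lemma opZ_zero (c : ℕ → ℝ) : opZ c 0 = 0 := by simp [opZ]

lemma abs_opX_le {c : ℕ → ℝ} (hc : ∀ n, |c n| ≤ 1) (n : ℕ) : |opX c n| ≤ 1 := by
  rcases Nat.eq_zero_or_pos n with rfl | hn
  · simp
  · have h1 : (1 : ℝ) ≤ n := by exact_mod_cast hn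
    rw [opX, abs_div, Nat.abs_cast, div_le_one (by linarith)]
    exact (hc n).trans h1

lemma abs_opY_le {c : ℕ → ℝ} (hc : ∀ n, |c n| ≤ 1) (n : ℕ) : |opY c n| ≤ 1 := by
  rcases Nat.eq_zero_or_pos n with rfl | hn
  · simp
  · have h1 : (0 : ℝ) < n := by exact_mod_cast hn
    rw [opY, abs_div, Nat.abs_cast, div_le_one h1]
    refine (Finset.abs_sum_le_sum_abs _ _).trans ((Finset.sum_le_sum fun i _ => hc i).trans ?_)
    simp

lemma abs_opZ_le {c : ℕ → ℝ} (hc : ∀ n, |c n| ≤ 1) (h0 : c 0 = 0) (n : ℕ) : |opZ c n| ≤ 1 := by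
  rcases Nat.eq_zero_or_pos n with rfl | hn
  · simp
  · have h1 : (0 : ℝ) < n := by exact_mod_cast hn
    -- Of the n + 1 summands the one at index 0 vanishes, leaving n of them against the denominator
    -- n.
    rw [opZ, abs_div, Nat.abs_cast, div_le_one h1, Finset.sum_range_succ', h0, add_zero]
    refine (Finset.abs_sum_le_sum_abs _ _).trans
      ((Finset.sum_le_sum fun i _ => hc (i + 1)).trans ?_)
    simp

lemma summable_norm_pseries {c : ℕ → ℝ} (hc : ∀ n, |c n| ≤ 1) {x : ℝ} (hx : |x| < 1) :
    Summable fun n => ‖c n * x ^ n‖ := by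
  refine Summable.of_nonneg_of_le (fun _ => norm_nonneg _) (fun n => ?_)
    (summable_geometric_of_lt_one (abs_nonneg x) hx)
  rw [norm_mul, norm_pow, Real.norm_eq_abs, Real.norm_eq_abs]
  exact mul_le_of_le_one_left (by positivity) (hc n)

lemma hasDerivAt_pseries {c : ℕ → ℝ} (hc : ∀ n, |c n| ≤ 1) {x : ℝ} (hx : |x| < 1) :
    HasDerivAt (pseries c) (∑' n : ℕ, ((n + 1 : ℕ) : ℝ) * c (n + 1) * x ^ n) x := by
  obtain ⟨r, hxr, hr1⟩ := exists_between hx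
  have hr0 : 0 < r := (abs_nonneg x).trans_lt hxr
  have hsum : Summable fun n : ℕ => ‖(n : ℝ) ^ 1 * r ^ n‖ :=
    summable_norm_pow_mul_geometric_of_norm_lt_one 1 (by rwa [Real.norm_eq_abs, abs_of_pos hr0])
  have hsum' : Summable fun n : ℕ => (n : ℝ) * r ^ (n - 1) := by
    refine (hsum.mul_left r⁻¹).congr fun n => ?_
    rw [Real.norm_eq_abs, abs_of_nonneg (by positivity)]
    rcases n with _ | n
    · simp
    · simp only [Nat.add_sub_cancel, pow_succ]; field_simp
  have hb : ∀ (n : ℕ), ∀ y ∈ Set.Ioo (-r) r, ‖c n * (n * y ^ (n - 1))‖ ≤ n * r ^ (n - 1) := by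
    intro n y hy
    rw [norm_mul, norm_mul, norm_pow, Real.norm_eq_abs, Real.norm_eq_abs, Real.norm_eq_abs,
      Nat.abs_cast]
    have : |y| ≤ r := abs_le.2 ⟨hy.1.le, hy.2.le⟩
    calc |c n| * (n * |y| ^ (n - 1)) ≤ 1 * (n * |y| ^ (n - 1)) := by
          gcongr; exact hc n
      _ ≤ n * r ^ (n - 1) := by rw [one_mul]; gcongr
  have hxm : x ∈ Set.Ioo (-r) r := abs_lt.1 hxr
  have key := hasDerivAt_tsum_of_isPreconnected (g := fun n y => c n * y ^ n)
    (g' := fun n y => c n * (n * y ^ (n - 1))) hsum' isOpen_Ioo isPreconnected_Ioo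
    (fun n y _ => (hasDerivAt_pow n y).const_mul (c n)) hb hxm
    (summable_norm_pseries hc hx).of_norm hxm
  have hs : Summable fun n : ℕ => c n * (n * x ^ (n - 1)) :=
    Summable.of_norm_bounded hsum' fun n => hb n x hxm
  rw [hs.tsum_eq_zero_add] at key
  refine HasDerivAt.congr_deriv (f := pseries c) key ?_
  simp only [Nat.cast_zero, zero_mul, mul_zero, zero_add, Nat.add_sub_cancel]
  exact tsum_congr fun n => by ring

/-- Cauchy product with the geometric series. -/
lemma tsum_partialSums {c : ℕ → ℝ} (hc : ∀ n, |c n| ≤ 1) {x : ℝ} (hx : |x| < 1) :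
    HasSum (fun n => (∑ m ∈ Finset.range (n + 1), c m) * x ^ n) (pseries c x / (1 - x)) := by
  have h1 := summable_norm_pseries hc hx
  have h2 : Summable fun n : ℕ => ‖x ^ n‖ := summable_norm_geometric_of_norm_lt_one hx
  have key := tsum_mul_tsum_eq_tsum_sum_range_of_summable_norm h1 h2
  have hsum := summable_norm_sum_mul_range_of_summable_norm h1 h2
  have e : ∀ n, ∑ k ∈ Finset.range (n + 1), c k * x ^ k * x ^ (n - k)
      = (∑ m ∈ Finset.range (n + 1), c m) * x ^ n := by
    intro n
    rw [Finset.sum_mul]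
    refine Finset.sum_congr rfl fun k hk => ?_
    rw [mul_assoc, ← pow_add, Nat.add_sub_cancel' (Nat.lt_succ_iff.1 (Finset.mem_range.1 hk))]
  simp only [e] at key hsum
  rw [tsum_geometric_of_norm_lt_one hx, ← div_eq_mul_inv] at key
  rw [pseries, key]
  exact hsum.of_norm.hasSum

lemma tsum_shift {d : ℕ → ℝ} {x s : ℝ} (hd : HasSum (fun n => d n * x ^ n) s) (h0 : d 0 = 0)
    (hx : x ≠ 0) : ∑' n, d (n + 1) * x ^ n = s / x := by
  have h := hd.summable.tsum_eq_zero_add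
  rw [hd.tsum_eq, h0, zero_mul, zero_add] at h
  rw [h, eq_div_iff hx, ← tsum_mul_right]
  exact tsum_congr fun n => by ring

lemma hasDerivAt_pseries_opX {c : ℕ → ℝ} (hc : ∀ n, |c n| ≤ 1) (h0 : c 0 = 0) {x : ℝ}
    (hx : |x| < 1) (hx0 : x ≠ 0) : HasDerivAt (pseries (opX c)) (pseries c x / x) x := by
  have h := hasDerivAt_pseries (abs_opX_le hc) hx
  rw [← tsum_shift (s := pseries c x) (summable_norm_pseries hc hx).of_norm.hasSum h0 hx0]
  convert h using 4 with n
  rw [opX]; field_simp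

lemma hasDerivAt_pseries_opY {c : ℕ → ℝ} (hc : ∀ n, |c n| ≤ 1) {x : ℝ}
    (hx : |x| < 1) : HasDerivAt (pseries (opY c)) (pseries c x / (1 - x)) x := by
  have h := hasDerivAt_pseries (abs_opY_le hc) hx
  rw [← (tsum_partialSums hc hx).tsum_eq]
  convert h using 4 with n
  rw [opY]; field_simp

lemma hasDerivAt_pseries_opZ {c : ℕ → ℝ} (hc : ∀ n, |c n| ≤ 1) (h0 : c 0 = 0) {x : ℝ}
    (hx : |x| < 1) (hx0 : x ≠ 0) :
    HasDerivAt (pseries (opZ c)) (pseries c x / (x * (1 - x))) x := by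
  have h := hasDerivAt_pseries (abs_opZ_le hc h0) hx
  rw [mul_comm, ← div_div, ← tsum_shift (tsum_partialSums hc hx) (by simp [h0]) hx0]
  convert h using 4 with n
  rw [opZ]; field_simp

@[simp] lemma pseries_zero (c : ℕ → ℝ) : pseries c 0 = c 0 := by
  rw [pseries, tsum_eq_single 0 fun n hn => by simp [hn]]; simp

lemma continuousAt_pseries {c : ℕ → ℝ} (hc : ∀ n, |c n| ≤ 1) {x : ℝ} (hx : |x| < 1) :
    ContinuousAt (pseries c) x := (hasDerivAt_pseries hc hx).continuousAt

lemma analyticOnNhd_pseries {c : ℕ → ℝ} (hc : ∀ n, |c n| ≤ 1) :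
    AnalyticOnNhd ℝ (pseries c) (Set.Ioo (-1) 1) := by
  have hr : (1 : ENNReal) ≤ (FormalMultilinearSeries.ofScalars ℝ c).radius := by
    refine FormalMultilinearSeries.le_radius_of_bound _ 1 (r := 1) fun n => ?_
    rw [FormalMultilinearSeries.ofScalars_norm]
    simpa using hc n
  have h := (FormalMultilinearSeries.hasFPowerSeriesOnBall _
    (one_pos.trans_le hr)).analyticOnNhd
  have e : (FormalMultilinearSeries.ofScalars ℝ c).sum = pseries c := by
    funext x
    exact (FormalMultilinearSeries.ofScalars_sum_eq c x).trans (by simp [pseries])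
  rw [e] at h
  refine h.mono fun x hx => ?_
  rw [Metric.mem_eball, edist_zero_right]
  refine lt_of_lt_of_le ?_ hr
  rw [← ofReal_norm, ENNReal.ofReal_lt_one]
  exact abs_lt.2 hx

/-! ### Words

A word is a list of letters, the outermost form of an iterated integral first; the letter `true`
stands for `dt / (1 - t)`. -/

/-- The word of a composition. -/
def wordOf : List ℕ → List Bool
  | [] => []
  | k :: ks => List.replicate (k - 1) false ++ true :: wordOf ks

/-- The innermost letter of the word, if there is one, is `true`. -/
def Admissible : List Bool → Prop
  | [] => True
  | true :: b => Admissible b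
  | false :: b => b ≠ [] ∧ Admissible b

lemma admissible_replicate_append {b : List Bool} (h0 : b ≠ []) (hb : Admissible b) (n : ℕ) :
    Admissible (List.replicate n false ++ b) := by
  induction n with
  | zero => exact hb
  | succ n ih => exact ⟨by simp [h0], ih⟩

lemma admissible_wordOf (l : List ℕ) : Admissible (wordOf l) := by
  induction l with
  | nil => trivial
  | cons k ks ih => exact admissible_replicate_append (b := true :: wordOf ks) (List.cons_ne_nil _ _) ih _

lemma wordOf_ne_nil {l : List ℕ} (hl : l ≠ []) : wordOf l ≠ [] := by
  cases l with
  | nil => exact absurd rfl hl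
  | cons k ks => simp [wordOf]

lemma count_true_wordOf (l : List ℕ) : (wordOf l).count true = l.length := by
  induction l with
  | nil => rfl
  | cons k ks ih => simp [wordOf, List.count_append, List.count_replicate, ih]

/-- The coefficients of the iterated integral of the word with `false` standing for `dt / t`. -/
def liCoeff : List Bool → ℕ → ℝ
  | [] => fun n => if n = 0 then 1 else 0
  | true :: b => opY (liCoeff b)
  | false :: b => opX (liCoeff b)

/-- The coefficients of the iterated integral of the word with `false` standing for
`dt / (t (1 - t))`. -/
def landenCoeff : List Bool → ℕ → ℝ
  | [] => fun n => if n = 0 then 1 else 0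
  | true :: b => opY (landenCoeff b)
  | false :: b => opZ (landenCoeff b)

lemma liCoeff_zero {b : List Bool} (hb : b ≠ []) : liCoeff b 0 = 0 := by
  match b with
  | true :: _ => exact opY_zero _
  | false :: _ => exact opX_zero _

lemma landenCoeff_zero {b : List Bool} (hb : b ≠ []) : landenCoeff b 0 = 0 := by
  match b with
  | true :: _ => exact opY_zero _
  | false :: _ => exact opZ_zero _

lemma abs_liCoeff_le : ∀ (b : List Bool) (n : ℕ), |liCoeff b n| ≤ 1
  | [], n => by unfold liCoeff; split_ifs <;> simp
  | true :: b, n => abs_opY_le (abs_liCoeff_le b) n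
  | false :: b, n => abs_opX_le (abs_liCoeff_le b) n

lemma abs_landenCoeff_le : ∀ {b : List Bool}, Admissible b → ∀ n : ℕ, |landenCoeff b n| ≤ 1
  | [], _, n => by unfold landenCoeff; split_ifs <;> simp
  | true :: b, h, n => abs_opY_le (abs_landenCoeff_le (b := b) h) n
  | false :: b, h, n => abs_opZ_le (abs_landenCoeff_le (b := b) h.2) (landenCoeff_zero h.1) n

lemma pseries_landenCoeff_nil (x : ℝ) : pseries (landenCoeff []) x = 1 := by
  rw [pseries, tsum_eq_single 0 fun n hn => by simp [landenCoeff, hn]]; simp [landenCoeff]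

lemma pseries_liCoeff_nil (x : ℝ) : pseries (liCoeff []) x = 1 := pseries_landenCoeff_nil x

/-! ### The multiple polylogarithm series as a power series -/

/-- Strictly decreasing tuples of positive integers less than `N`. -/
def strictTuples (r N : ℕ) : Finset (Fin r → ℕ) :=
  (Fintype.piFinset fun _ => Finset.range N).filter fun p => StrictAnti p ∧ ∀ i, 0 < p i

lemma mem_strictTuples {r N : ℕ} {p : Fin r → ℕ} :
    p ∈ strictTuples r N ↔ (∀ i, p i < N) ∧ StrictAnti p ∧ ∀ i, 0 < p i := by
  simp [strictTuples, Fintype.mem_piFinset]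

lemma strictAnti_cons {r n : ℕ} {p : Fin r → ℕ} :
    StrictAnti (Fin.cons n p : Fin (r + 1) → ℕ) ↔ (∀ i, p i < n) ∧ StrictAnti p := by
  refine ⟨fun h => ⟨fun i => ?_, fun i j hij => ?_⟩, fun h i j hij => ?_⟩
  · simpa using h (Fin.succ_pos i)
  · simpa using h (Fin.succ_lt_succ_iff.2 hij)
  · induction j using Fin.cases with
    | zero => exact absurd hij (Fin.not_lt_zero i)
    | succ j =>
      induction i using Fin.cases with
      | zero => simpa using h.1 j
      | succ i => simpa using h.2 (Fin.succ_lt_succ_iff.1 hij)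

/-- The possible tails of a strictly decreasing tuple of positive integers with first entry `n`. -/
def tails (r n : ℕ) : Finset (Fin r → ℕ) := if n = 0 then ∅ else strictTuples r n

lemma mem_tails {r n : ℕ} {p : Fin r → ℕ} : p ∈ tails r n ↔
    StrictAnti (Fin.cons n p : Fin (r + 1) → ℕ) ∧
      ∀ i, 0 < (Fin.cons n p : Fin (r + 1) → ℕ) i := by
  rw [strictAnti_cons, Fin.forall_fin_succ, tails]
  split_ifs with h
  · simp [h]
  · simp only [Fin.cons_zero, Fin.cons_succ, mem_strictTuples]
    have := Nat.pos_of_ne_zero h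
    tauto

/-- The coefficients of the multiple polylogarithm series. -/
def mplCoeff : List ℕ → ℕ → ℝ
  | [] => fun n => if n = 0 then 1 else 0
  | k :: ks => fun n => (∑ m ∈ Finset.range n, mplCoeff ks m) / (n : ℝ) ^ k

lemma mplCoeff_eq_liCoeff : ∀ {l : List ℕ}, (∀ k ∈ l, 0 < k) → mplCoeff l = liCoeff (wordOf l)
  | [], _ => rfl
  | k :: ks, h => by
    have ih := mplCoeff_eq_liCoeff (l := ks) fun k hk => h k (List.mem_cons_of_mem _ hk)
    obtain ⟨j, rfl⟩ := Nat.exists_eq_add_of_lt (h k List.mem_cons_self)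
    have key : ∀ (j : ℕ) (b : List Bool) (n : ℕ),
        liCoeff (List.replicate j false ++ b) n = liCoeff b n / (n : ℝ) ^ j := by
      intro j b n
      induction j with
      | zero => simp
      | succ j ih =>
        rw [List.replicate_succ, List.cons_append, liCoeff, opX, ih, div_div, pow_succ]
    funext n
    rw [wordOf, key, liCoeff, opY, div_div, mplCoeff, ih]
    simp [pow_succ']

/-- Induction by splitting off the largest entry n; the tails are the strict tuples below n. -/
lemma sum_strictTuples : ∀ {r : ℕ} (k : Fin r → ℕ) {N : ℕ}, 0 < N →
    ∑ p ∈ strictTuples r N, ∏ i, 1 / (p i : ℝ) ^ k i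
      = ∑ m ∈ Finset.range N, mplCoeff (List.ofFn k) m
  | 0, k, N, hN => by
    have : strictTuples 0 N = {Fin.elim0} := by
      ext p
      simp only [mem_strictTuples, Finset.mem_singleton]
      exact ⟨fun _ => Subsingleton.elim _ _,
        fun _ => ⟨fun i => i.elim0, fun i => i.elim0, fun i => i.elim0⟩⟩
    rw [this]
    -- The empty tuple is matched by the coefficient at index 0, which lies in `range N` only for N
    -- > 0.
    simp [mplCoeff, hN.ne']
  | r + 1, k, N, hN => by
    have h1 : ∑ p ∈ strictTuples (r + 1) N, ∏ i, 1 / (p i : ℝ) ^ k i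
        = ∑ q ∈ (Finset.range N).sigma (tails r),
          1 / (q.1 : ℝ) ^ k 0 * ∏ i, 1 / (q.2 i : ℝ) ^ k i.succ := by
      refine Finset.sum_bij' (fun p _ => ⟨p 0, Fin.tail p⟩)
        (fun q _ => (Fin.cons q.1 q.2 : Fin (r + 1) → ℕ)) ?_ ?_ ?_ ?_ ?_
      · intro p hp
        rw [mem_strictTuples] at hp
        rw [Finset.mem_sigma, mem_tails, Fin.cons_self_tail, Finset.mem_range]
        exact ⟨hp.1 0, hp.2⟩
      · rintro ⟨n, q⟩ hq
        rw [Finset.mem_sigma, mem_tails, Finset.mem_range] at hq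
        rw [mem_strictTuples]
        refine ⟨?_, hq.2⟩
        rw [Fin.forall_fin_succ]
        refine ⟨hq.1, fun i => ?_⟩
        exact ((strictAnti_cons.1 hq.2.1).1 i).trans hq.1
      · intro p _
        exact Fin.cons_self_tail p
      · rintro ⟨n, q⟩ _
        simp
      · intro p _
        rw [Fin.prod_univ_succ]
        rfl
    rw [h1, Finset.sum_sigma]
    refine Finset.sum_congr rfl fun n _ => ?_
    dsimp only
    rw [← Finset.mul_sum, List.ofFn_succ, mplCoeff]
    rcases Nat.eq_zero_or_pos n with rfl | hn
    · simp [tails]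
    · rw [tails, if_neg hn.ne', sum_strictTuples _ hn, div_mul_eq_mul_div, one_mul]

/-- Strictly decreasing tuples of positive integers, sorted by the first entry. -/
def tupleEquiv (r : ℕ) :
    (Σ n : ℕ, {p : Fin r → ℕ // p ∈ tails r n}) ≃
      {n : Fin (r + 1) → ℕ // StrictAnti n ∧ ∀ i, 0 < n i} where
  toFun q := ⟨Fin.cons q.1 q.2.1, mem_tails.1 q.2.2⟩
  invFun p := ⟨p.1 0, Fin.tail p.1, by rw [mem_tails, Fin.cons_self_tail]; exact p.2⟩
  left_inv q := by rcases q with ⟨n, q, hq⟩; rfl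
  right_inv p := Subtype.ext (Fin.cons_self_tail p.1)

/-- Group the tuples by their first entry n₁, the only one whose power of x survives. The regrouping
is licensed by absolute convergence, read off from the same computation at |x|. -/
lemma mplSeries₁_eq {r : ℕ} (hr : 0 < r) (k : Fin r → ℕ) (hk : ∀ i, 0 < k i) {x : ℝ}
    (hx : |x| < 1) : mplSeries₁ k x = pseries (liCoeff (wordOf (List.ofFn k))) x := by
  obtain ⟨r, rfl⟩ := Nat.exists_eq_succ_of_ne_zero hr.ne'
  have hpos : ∀ k' ∈ List.ofFn k, 0 < k' := by
    intro k' h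
    obtain ⟨i, rfl⟩ := (List.mem_ofFn' k k').1 h
    exact hk i
  have hterm : ∀ (y : ℝ) (n : ℕ), ∑' p : {p : Fin r → ℕ // p ∈ tails r n},
      y ^ n / (n : ℝ) ^ k 0 * ∏ i, 1 / (p.1 i : ℝ) ^ k i.succ
        = liCoeff (wordOf (List.ofFn k)) n * y ^ n := by
    intro y n
    rw [Finset.tsum_subtype (tails r n)
      (fun p => y ^ n / (n : ℝ) ^ k 0 * ∏ i, 1 / (p i : ℝ) ^ k i.succ), ← Finset.mul_sum,
      ← mplCoeff_eq_liCoeff hpos, List.ofFn_succ, mplCoeff]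
    rcases Nat.eq_zero_or_pos n with rfl | hn
    · simp [tails]
    · rw [tails, if_neg hn.ne', sum_strictTuples _ hn]; ring
  have habs := (summable_norm_pseries (abs_liCoeff_le (wordOf (List.ofFn k)))
    (x := |x|) (by rwa [abs_abs])).of_norm
  rw [mplSeries₁, mplSeries, ← (tupleEquiv r).tsum_eq]
  have e : ∀ q : Σ n : ℕ, {p : Fin r → ℕ // p ∈ tails r n},
      (∏ i : Fin (r + 1), (if (i : ℕ) = 0 then x else 1) ^ ((tupleEquiv r q).1 i) /
        ((tupleEquiv r q).1 i : ℝ) ^ k i)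
      = x ^ q.1 / (q.1 : ℝ) ^ k 0 * ∏ i, 1 / (q.2.1 i : ℝ) ^ k i.succ := by
    intro q
    rw [Fin.prod_univ_succ]
    simp [tupleEquiv]
  simp only [e]
  have hs : Summable fun q : Σ n : ℕ, {p : Fin r → ℕ // p ∈ tails r n} =>
      x ^ q.1 / (q.1 : ℝ) ^ k 0 * ∏ i, 1 / (q.2.1 i : ℝ) ^ k i.succ := by
    apply Summable.of_norm
    have e2 : ∀ q : Σ n : ℕ, {p : Fin r → ℕ // p ∈ tails r n},
        ‖x ^ q.1 / (q.1 : ℝ) ^ k 0 * ∏ i, 1 / (q.2.1 i : ℝ) ^ k i.succ‖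
        = |x| ^ q.1 / (q.1 : ℝ) ^ k 0 * ∏ i, 1 / (q.2.1 i : ℝ) ^ k i.succ := by
      intro q
      rw [norm_mul, norm_div, norm_pow, Real.norm_eq_abs,
        Real.norm_of_nonneg (show (0 : ℝ) ≤ (q.1 : ℝ) ^ k 0 by positivity),
        Real.norm_of_nonneg (by positivity)]
    simp only [e2]
    rw [summable_sigma_of_nonneg (fun q => by positivity)]
    exact ⟨fun n => Summable.of_finite, habs.congr fun n => (hterm |x| n).symm⟩
  rw [hs.tsum_sigma' fun n => Summable.of_finite, pseries]
  exact tsum_congr fun n => hterm x n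

/-! ### The Landen transformation -/

/-- The derivative is asked for only in the open interval because dt/t and dt/(t(1 - t)) are
singular at 0. -/
lemma eq_of_hasDerivAt_zero {f : ℝ → ℝ} {x : ℝ} (hx : 0 ≤ x)
    (hf : ∀ t ∈ Set.Icc 0 x, ContinuousAt f t) (hf' : ∀ t ∈ Set.Ioo 0 x, HasDerivAt f 0 t) :
    f x = f 0 := by
  rcases hx.eq_or_lt with rfl | hx
  · rfl
  obtain ⟨c, -, hc⟩ := exists_hasDerivAt_eq_slope f (fun _ => 0) hx
    (fun t ht => (hf t ht).continuousWithinAt) hf'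
  rw [eq_div_iff (by linarith)] at hc
  linarith

lemma le_of_hasDerivAt_nonneg {f f' : ℝ → ℝ} {x : ℝ} (hx : 0 ≤ x)
    (hf : ∀ t ∈ Set.Icc 0 x, ContinuousAt f t) (hf' : ∀ t ∈ Set.Ioo 0 x, HasDerivAt f (f' t) t)
    (h0 : ∀ t ∈ Set.Ioo 0 x, 0 ≤ f' t) : f 0 ≤ f x := by
  rcases hx.eq_or_lt with rfl | hx
  · rfl
  obtain ⟨c, hcm, hc⟩ := exists_hasDerivAt_eq_slope f f' hx
    (fun t ht => (hf t ht).continuousWithinAt) hf'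
  have := h0 c hcm
  rw [hc, sub_zero, div_nonneg_iff] at this
  rcases this with h | h <;> linarith [h.1, h.2]

lemma div_sub_one_involutive {x : ℝ} (hx : x < 1) : x / (x - 1) / (x / (x - 1) - 1) = x := by
  have : x - 1 ≠ 0 := by linarith
  field_simp
  ring

lemma hasDerivAt_div_sub_one {x : ℝ} (hx : x < 1) :
    HasDerivAt (fun t : ℝ => t / (t - 1)) (-1 / (x - 1) ^ 2) x := by
  have : x - 1 ≠ 0 := by linarith
  refine ((hasDerivAt_id x).div ((hasDerivAt_id x).sub_const 1) this).congr_deriv ?_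
  simp

lemma abs_div_sub_one_lt {x : ℝ} (hx : x < 1 / 2) : |x / (x - 1)| < 1 := by
  have : x - 1 < 0 := by linarith
  rw [abs_lt]
  constructor
  · rw [lt_div_iff_of_neg this]; linarith
  · rw [div_lt_iff_of_neg this]; linarith

/-- Induction on the word: both sides vanish at 0 and have the same derivative by the substitution
rule for the two forms, each `true` contributing a sign. The bound x < 1/2 keeps x/(x - 1) inside
the disc of convergence. -/
lemma landen_aux : ∀ {b : List Bool}, Admissible b → ∀ x ∈ Set.Ico (0 : ℝ) (1 / 2),
    pseries (liCoeff b) (x / (x - 1)) = (-1) ^ b.count true * pseries (landenCoeff b) x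
  | [], _, x, _ => by rw [pseries_landenCoeff_nil, pseries_liCoeff_nil]; simp
  | a :: b, h, x, hx => by
    have hb : Admissible b := by cases a; exacts [h.2, h]
    have key := eq_of_hasDerivAt_zero (x := x) (f := fun t =>
      pseries (liCoeff (a :: b)) (t / (t - 1))
        - (-1) ^ (a :: b).count true * pseries (landenCoeff (a :: b)) t) hx.1 ?_ ?_
    · simp only [zero_div, pseries_zero, liCoeff_zero (List.cons_ne_nil a b),
        landenCoeff_zero (List.cons_ne_nil a b), mul_zero, sub_zero] at key
      linarith
    · intro t ht
      have ht2 : t < 1 / 2 := ht.2.trans_lt hx.2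
      refine ContinuousAt.sub ?_ (continuousAt_const.mul ?_)
      · exact ContinuousAt.comp (f := fun t : ℝ => t / (t - 1))
          (continuousAt_pseries (abs_liCoeff_le _) (abs_div_sub_one_lt ht2))
          (hasDerivAt_div_sub_one (by linarith)).continuousAt
      · exact continuousAt_pseries (abs_landenCoeff_le h)
          (abs_lt.2 ⟨by linarith [ht.1], by linarith⟩)
    · intro t ht
      have ht2 : t < 1 / 2 := ht.2.trans hx.2
      have ht1 : |t| < 1 := abs_lt.2 ⟨by linarith [ht.1], by linarith⟩
      have h1 : t - 1 ≠ 0 := by linarith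
      have h1' : 1 - t ≠ 0 := by linarith
      have h0 : t ≠ 0 := ht.1.ne'
      have ih := landen_aux hb t ⟨ht.1.le, ht2⟩
      have hphi := hasDerivAt_div_sub_one (x := t) (by linarith)
      cases a with
      | true =>
        have d1 := (hasDerivAt_pseries_opY (abs_liCoeff_le b) (abs_div_sub_one_lt ht2)).scomp t hphi
        have d2 := (hasDerivAt_pseries_opY (abs_landenCoeff_le hb) ht1).const_mul
          ((-1) ^ (true :: b).count true)
        refine (d1.sub d2).congr_deriv ?_
        rw [ih, List.count_cons_self, smul_eq_mul, pow_succ]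
        have : 1 - t / (t - 1) = 1 / (1 - t) := by field_simp; ring
        rw [this]
        field_simp
        ring
      | false =>
        have d1 := (hasDerivAt_pseries_opX (abs_liCoeff_le b) (liCoeff_zero h.1)
          (abs_div_sub_one_lt ht2) (div_ne_zero h0 h1)).scomp t hphi
        have d2 := (hasDerivAt_pseries_opZ (abs_landenCoeff_le hb) (landenCoeff_zero h.1) ht1
          h0).const_mul ((-1) ^ (false :: b).count true)
        refine (d1.sub d2).congr_deriv ?_
        rw [ih, List.count_cons_of_ne (by decide), smul_eq_mul]
        field_simp
        ring

/-- Glue the series of Li on y ≥ 0 to the transformed series in y/(y - 1) on y < 0. They agree on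
(-1, 0) by the Landen identity, since y ↦ y/(y - 1) is an involution that carries (-1, 0) into (0,
1/2). -/
lemma exists_isMPLContinuation {r : ℕ} (hr : 0 < r) (k : Fin r → ℕ) (hk : ∀ i, 0 < k i) :
    ∃ f : ℝ → ℝ, IsMPLContinuation k f ∧ ∀ x ∈ Set.Ioo (0 : ℝ) 1,
      f (x / (x - 1)) = (-1) ^ r * pseries (landenCoeff (wordOf (List.ofFn k))) x := by
  set b := wordOf (List.ofFn k) with hbdef
  have hb : Admissible b := admissible_wordOf _
  have hcount : b.count true = r := by rw [hbdef, count_true_wordOf, List.length_ofFn]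
  have hneg : ∀ {y : ℝ}, y < 0 → 0 < y / (y - 1) ∧ y / (y - 1) < 1 := by
    intro y hy
    refine ⟨div_pos_of_neg_of_neg hy (by linarith), ?_⟩
    rw [div_lt_iff_of_neg (by linarith)]; linarith
  let g : ℝ → ℝ := fun y => (-1) ^ r * pseries (landenCoeff b) (y / (y - 1))
  let f : ℝ → ℝ := fun y => if y < 0 then g y else pseries (liCoeff b) y
  have hfL : ∀ y ∈ Set.Ioo (-1 : ℝ) 1, f y = pseries (liCoeff b) y := by
    intro y hy
    by_cases h0 : y < 0
    · have hx := hneg h0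
      have hx2 : y / (y - 1) < 1 / 2 := by
        rw [div_lt_iff_of_neg (by linarith)]; linarith [hy.1]
      have := landen_aux hb (y / (y - 1)) ⟨hx.1.le, hx2⟩
      rw [div_sub_one_involutive hy.2, hcount] at this
      simp only [f, g, if_pos h0, this]
    · simp only [f, if_neg h0]
  refine ⟨f, ⟨fun y hy => ?_, fun x hx => ?_⟩, fun x hx => ?_⟩
  · rw [Set.mem_Iio] at hy
    by_cases h0 : y < 0
    · have hg : AnalyticAt ℝ g y := by
        refine analyticAt_const.mul (AnalyticAt.fun_comp (g := pseries (landenCoeff b)) ?_ ?_)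
        · exact analyticOnNhd_pseries (abs_landenCoeff_le hb) _
            ⟨by linarith [(hneg h0).1], (hneg h0).2⟩
        · exact analyticAt_id.fun_div (analyticAt_id.fun_sub analyticAt_const)
            (show y - 1 ≠ 0 by linarith)
      refine hg.congr ?_
      filter_upwards [Iio_mem_nhds h0] with z hz
      simp only [f]
      rw [if_pos (Set.mem_Iio.1 hz)]
    · have hy1 : y ∈ Set.Ioo (-1 : ℝ) 1 := ⟨by linarith, hy⟩
      refine (analyticOnNhd_pseries (abs_liCoeff_le b) y hy1).congr ?_
      filter_upwards [Ioo_mem_nhds hy1.1 hy1.2] with z hz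
      rw [hfL z hz]
  · rw [hfL x hx, mplSeries₁_eq hr k hk (abs_lt.2 hx)]
  · have h0 : x / (x - 1) < 0 := div_neg_of_pos_of_neg hx.1 (by linarith [hx.2])
    simp only [f, g, if_pos h0, div_sub_one_involutive hx.2]

lemma Li_div_sub_one {r : ℕ} (hr : 0 < r) (k : Fin r → ℕ) (hk : ∀ i, 0 < k i) {x : ℝ}
    (hx : x ∈ Set.Ioo (0 : ℝ) 1) :
    Li k (x / (x - 1)) = (-1) ^ r * pseries (landenCoeff (wordOf (List.ofFn k))) x := by
  obtain ⟨f, hf, hfx⟩ := exists_isMPLContinuation hr k hk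
  have hex : ∃ f : ℝ → ℝ, IsMPLContinuation k f := ⟨f, hf⟩
  have hc := hex.choose_spec
  -- The continuation selected by choice is the explicit one, by the identity theorem.
  have heq : Set.EqOn hex.choose f (Set.Iio 1) := by
    refine hc.1.eqOn_of_preconnected_of_eventuallyEq hf.1 isPreconnected_Iio (z₀ := 0)
      (by simp) ?_
    filter_upwards [Ioo_mem_nhds (show (-1 : ℝ) < 0 by norm_num) one_pos] with z hz
    rw [hc.2 z hz, hf.2 z hz]
  rw [Li, dif_pos hex, heq, hfx x hx]
  have h0 : x / (x - 1) < 0 := div_neg_of_pos_of_neg hx.1 (by linarith [hx.2])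
  exact h0.trans one_pos

/-! ### Growth of the iterated integrals -/

lemma abs_lt_one_of_mem_Ico {x : ℝ} (hx : x ∈ Set.Ico (0 : ℝ) 1) : |x| < 1 :=
  abs_lt.2 ⟨by linarith [hx.1], hx.2⟩

/-- The derivative of the iterated integral of the word `a :: b`. -/
def landenDeriv (a : Bool) (b : List Bool) (x : ℝ) : ℝ :=
  if a then pseries (landenCoeff b) x / (1 - x) else pseries (landenCoeff b) x / (x * (1 - x))

lemma Admissible.tail {a : Bool} {b : List Bool} (h : Admissible (a :: b)) : Admissible b := by
  cases a; exacts [h.2, h]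

lemma hasDerivAt_landen {a : Bool} {b : List Bool} (h : Admissible (a :: b)) {x : ℝ}
    (hx : x ∈ Set.Ioo (0 : ℝ) 1) :
    HasDerivAt (pseries (landenCoeff (a :: b))) (landenDeriv a b x) x := by
  have hx1 := abs_lt_one_of_mem_Ico (Set.Ioo_subset_Ico_self hx)
  cases a with
  | true => exact hasDerivAt_pseries_opY (abs_landenCoeff_le (b := b) h) hx1
  | false =>
    exact hasDerivAt_pseries_opZ (abs_landenCoeff_le (b := b) h.2) (landenCoeff_zero h.1) hx1
      hx.1.ne'

lemma continuousAt_landen {b : List Bool} (hb : Admissible b) {x : ℝ}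
    (hx : x ∈ Set.Ico (0 : ℝ) 1) : ContinuousAt (pseries (landenCoeff b)) x :=
  continuousAt_pseries (abs_landenCoeff_le hb) (abs_lt_one_of_mem_Ico hx)

lemma pseries_landen_nonneg : ∀ {b : List Bool}, Admissible b → ∀ x ∈ Set.Ico (0 : ℝ) 1,
    0 ≤ pseries (landenCoeff b) x
  | [], _, x, _ => by rw [pseries_landenCoeff_nil]; exact zero_le_one
  | a :: b, h, x, hx => by
    have key := le_of_hasDerivAt_nonneg (x := x) (f := pseries (landenCoeff (a :: b)))
      (f' := landenDeriv a b) hx.1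
      (fun t ht => continuousAt_landen h ⟨ht.1, ht.2.trans_lt hx.2⟩)
      (fun t ht => hasDerivAt_landen h ⟨ht.1, ht.2.trans hx.2⟩) ?_
    · rwa [pseries_zero, landenCoeff_zero (List.cons_ne_nil a b)] at key
    · intro t ht
      have ht1 : t < 1 := ht.2.trans hx.2
      have ih := pseries_landen_nonneg (b := b) h.tail t ⟨ht.1.le, ht1⟩
      have h1 : 0 < 1 - t := by linarith
      have h2 := ht.1
      unfold landenDeriv
      split_ifs <;> positivity

/-- The iterated integrals grow more slowly than any negative power of 1 - x: compare derivatives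
with C/ε · (1 - x)^(-ε). The version with a factor x, for nonempty words, absorbs the division by x
in the next integration. -/
lemma exists_pseries_landen_le {ε : ℝ} (h0 : 0 < ε) (h1 : ε ≤ 1) :
    ∀ {b : List Bool}, Admissible b → ∃ C : ℝ, 0 ≤ C ∧ ∀ x ∈ Set.Ico (0 : ℝ) 1,
      pseries (landenCoeff b) x ≤ C * (1 - x) ^ (-ε) ∧
      (b ≠ [] → pseries (landenCoeff b) x ≤ C * x * (1 - x) ^ (-ε))
  | [], _ => by
    refine ⟨1, zero_le_one, fun x hx => ⟨?_, fun h => absurd rfl h⟩⟩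
    rw [pseries_landenCoeff_nil, one_mul]
    exact Real.one_le_rpow_of_pos_of_le_one_of_nonpos (by linarith [hx.2]) (by linarith [hx.1])
      (by linarith)
  | a :: b, h => by
    obtain ⟨C, hC, hle⟩ := exists_pseries_landen_le h0 h1 (b := b) h.tail
    refine ⟨C / ε, by positivity, fun x hx => ?_⟩
    have hx1 : 0 < 1 - x := by linarith [hx.2]
    have hpow : ∀ t < (1 : ℝ), HasDerivAt (fun t : ℝ => C / ε * (1 - t) ^ (-ε))
        (C * (1 - t) ^ (-ε - 1)) t := by
      intro t ht
      have hb : HasDerivAt (fun t : ℝ => 1 - t) (-1) t := by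
        simpa using (hasDerivAt_id t).const_sub 1
      refine ((hb.rpow_const (p := -ε) (Or.inl (by linarith))).const_mul (C / ε)).congr_deriv ?_
      field_simp
    have key := le_of_hasDerivAt_nonneg (x := x)
      (f := fun t => C / ε * (1 - t) ^ (-ε) - pseries (landenCoeff (a :: b)) t)
      (f' := fun t => C * (1 - t) ^ (-ε - 1) - landenDeriv a b t) hx.1
      (fun t ht => (hpow t (ht.2.trans_lt hx.2)).continuousAt.sub
        (continuousAt_landen h ⟨ht.1, ht.2.trans_lt hx.2⟩))
      (fun t ht => (hpow t (ht.2.trans hx.2)).sub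
        (hasDerivAt_landen h ⟨ht.1, ht.2.trans hx.2⟩)) ?_
    · simp only [pseries_zero, landenCoeff_zero (List.cons_ne_nil a b), sub_zero, Real.one_rpow]
        at key
      -- Here ε ≤ 1 enters; the inequality says (1 - x)^(-ε) - 1 ≤ x (1 - x)^(-ε), which produces
      -- the factor x.
      have hx2 : (1 - x) ^ (-ε) * (1 - x) ≤ 1 := by
        rw [← Real.rpow_add_one hx1.ne']
        exact Real.rpow_le_one hx1.le (by linarith [hx.1]) (by linarith)
      have hCε : 0 ≤ C / ε := by positivity
      have hp : 0 ≤ (1 - x) ^ (-ε) := by positivity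
      have hmain : pseries (landenCoeff (a :: b)) x ≤ C / ε * x * (1 - x) ^ (-ε) := by
        nlinarith [mul_le_mul_of_nonneg_left hx2 hCε]
      refine ⟨hmain.trans ?_, fun _ => hmain⟩
      have : C / ε * x ≤ C / ε := mul_le_of_le_one_right hCε hx.2.le
      gcongr
    · intro t ht
      have ht1 : 0 < 1 - t := by linarith [ht.2, hx.2]
      have ht0 := ht.1
      have ih := hle t ⟨ht.1.le, ht.2.trans hx.2⟩
      rw [sub_nonneg, Real.rpow_sub_one ht1.ne', landenDeriv]
      cases a with
      | true =>
        rw [if_pos rfl, ← mul_div_assoc]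
        exact div_le_div_of_nonneg_right ih.1 ht1.le
      | false =>
        rw [if_neg (by decide), ← mul_div_assoc, ← div_div]
        refine div_le_div_of_nonneg_right ?_ ht1.le
        rw [div_le_iff₀ ht0]
        refine (ih.2 h.1).trans (le_of_eq (by ring))

/-! ### Mellin transforms -/

lemma integrableOn_one_sub_rpow {p : ℝ} (hp : -1 < p) :
    IntegrableOn (fun x : ℝ => (1 - x) ^ p) (Set.Ioo 0 1) := by
  have h := (intervalIntegral.intervalIntegrable_rpow' (a := 0) (b := 1) hp).comp_sub_left 1
  rw [sub_zero, sub_self] at h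
  have h2 := h.symm
  rw [intervalIntegrable_iff_integrableOn_Ioo_of_le zero_le_one] at h2
  exact h2

lemma norm_one_sub_cpow {x : ℝ} (hx : x < 1) (s : ℂ) :
    ‖((1 - x : ℝ) : ℂ) ^ s‖ = (1 - x) ^ s.re :=
  Complex.norm_cpow_eq_rpow_re_of_pos (by linarith) s

lemma continuousAt_one_sub_cpow {x : ℝ} (hx : x < 1) (s : ℂ) :
    ContinuousAt (fun x : ℝ => ((1 - x : ℝ) : ℂ) ^ s) x := by
  refine ContinuousAt.cpow ?_ continuousAt_const (Complex.ofReal_mem_slitPlane.2 (by linarith))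
  fun_prop

lemma integrableOn_of_le_rpow {f : ℝ → ℂ} (hf : ∀ x ∈ Set.Ioo (0 : ℝ) 1, ContinuousAt f x)
    {C p : ℝ} (hp : -1 < p) (hle : ∀ x ∈ Set.Ioo (0 : ℝ) 1, ‖f x‖ ≤ C * (1 - x) ^ p) :
    IntegrableOn f (Set.Ioo 0 1) := by
  refine Integrable.mono' ((integrableOn_one_sub_rpow hp).const_mul C) ?_ ?_
  · exact ContinuousOn.aestronglyMeasurable (fun x hx => (hf x hx).continuousWithinAt)
      measurableSet_Ioo
  · exact (ae_restrict_iff' measurableSet_Ioo).2 (Eventually.of_forall hle)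

/-- The integrand of the Mellin transform of an iterated integral. -/
def mellinFun (b : List Bool) (s : ℂ) (x : ℝ) : ℂ :=
  (pseries (landenCoeff b) x : ℂ) * ((1 - x : ℝ) : ℂ) ^ (s - 1)

/-- `∫ F_b(x) (1 - x) ^ (s - 1)`. -/
def mellin (b : List Bool) (s : ℂ) : ℂ := ∫ x in Set.Ioo (0 : ℝ) 1, mellinFun b s x

/-- `∫ F_b(x) (1 - x) ^ (s - 1)` for real `s`. -/
def mellinReal (b : List Bool) (s : ℝ) : ℝ :=
  ∫ x in Set.Ioo (0 : ℝ) 1, pseries (landenCoeff b) x * (1 - x) ^ (s - 1)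

lemma norm_mellinFun {b : List Bool} (hb : Admissible b) (s : ℂ) {x : ℝ}
    (hx : x ∈ Set.Ico (0 : ℝ) 1) :
    ‖mellinFun b s x‖ = pseries (landenCoeff b) x * (1 - x) ^ (s.re - 1) := by
  rw [mellinFun, norm_mul, norm_one_sub_cpow hx.2, Complex.norm_real,
    Real.norm_of_nonneg (pseries_landen_nonneg hb x hx), Complex.sub_re, Complex.one_re]

lemma continuousAt_mellinFun {b : List Bool} (hb : Admissible b) (s : ℂ) {x : ℝ}
    (hx : x ∈ Set.Ico (0 : ℝ) 1) : ContinuousAt (mellinFun b s) x :=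
  (Complex.continuous_ofReal.continuousAt.comp (continuousAt_landen hb hx)).mul
    (continuousAt_one_sub_cpow hx.2 _)

/-- The growth bound needs ε ≤ 1; integrability and the vanishing of the boundary term at 1 need ε <
Re s. -/
lemma exists_exponent {s : ℂ} (hs : 0 < s.re) : ∃ ε : ℝ, 0 < ε ∧ ε ≤ 1 ∧ ε < s.re :=
  ⟨min 1 (s.re / 2), by positivity, min_le_left _ _, (min_le_right _ _).trans_lt (by linarith)⟩

lemma integrableOn_mellinFun {b : List Bool} (hb : Admissible b) {s : ℂ} (hs : 0 < s.re) :
    IntegrableOn (mellinFun b s) (Set.Ioo 0 1) := by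
  obtain ⟨ε, h0, h1, h2⟩ := exists_exponent hs
  obtain ⟨C, hC, hle⟩ := exists_pseries_landen_le h0 h1 hb
  refine integrableOn_of_le_rpow (C := C) (p := -ε + (s.re - 1))
    (fun x hx => continuousAt_mellinFun hb s (Set.Ioo_subset_Ico_self hx)) (by linarith)
    fun x hx => ?_
  have hx1 : 0 < 1 - x := by linarith [hx.2]
  rw [norm_mellinFun hb s (Set.Ioo_subset_Ico_self hx), Real.rpow_add hx1, ← mul_assoc]
  exact mul_le_mul_of_nonneg_right (hle x (Set.Ioo_subset_Ico_self hx)).1 (by positivity)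

lemma integrableOn_mellinFun_div {b : List Bool} (hb : Admissible b) (hne : b ≠ []) {s : ℂ}
    (hs : 0 < s.re) : IntegrableOn (fun x : ℝ => mellinFun b s x / x) (Set.Ioo 0 1) := by
  obtain ⟨ε, h0, h1, h2⟩ := exists_exponent hs
  obtain ⟨C, hC, hle⟩ := exists_pseries_landen_le h0 h1 hb
  refine integrableOn_of_le_rpow (C := C) (p := -ε + (s.re - 1))
    (fun x hx => (continuousAt_mellinFun hb s (Set.Ioo_subset_Ico_self hx)).div
      Complex.continuous_ofReal.continuousAt (Complex.ofReal_ne_zero.2 hx.1.ne')) (by linarith)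
    fun x hx => ?_
  have hx1 : 0 < 1 - x := by linarith [hx.2]
  have hx0 := hx.1
  rw [norm_div, norm_mellinFun hb s (Set.Ioo_subset_Ico_self hx), Complex.norm_real,
    Real.norm_of_nonneg hx0.le, Real.rpow_add hx1, div_le_iff₀ hx0]
  calc _ ≤ (C * x * (1 - x) ^ (-ε)) * (1 - x) ^ (s.re - 1) :=
        mul_le_mul_of_nonneg_right ((hle x (Set.Ioo_subset_Ico_self hx)).2 hne) (by positivity)
    _ = _ := by ring

lemma mellin_ofReal (b : List Bool) (s : ℝ) : mellin b s = mellinReal b s := by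
  rw [mellin, mellinReal, ← integral_complex_ofReal]
  refine setIntegral_congr_fun measurableSet_Ioo fun x hx => ?_
  simp only [mellinFun]
  rw [Complex.ofReal_mul, Complex.ofReal_cpow (by linarith [hx.2])]
  push_cast
  rfl

lemma integral_norm_mellinFun {b : List Bool} (hb : Admissible b) (s : ℂ) :
    ∫ x in Set.Ioo (0 : ℝ) 1, ‖mellinFun b s x‖ = mellinReal b s.re :=
  setIntegral_congr_fun measurableSet_Ioo fun _ hx =>
    norm_mellinFun hb s (Set.Ioo_subset_Ico_self hx)

lemma mellinReal_nonneg {b : List Bool} (hb : Admissible b) (s : ℝ) : 0 ≤ mellinReal b s :=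
  setIntegral_nonneg measurableSet_Ioo fun x hx =>
    mul_nonneg (pseries_landen_nonneg hb x (Set.Ioo_subset_Ico_self hx))
      (Real.rpow_nonneg (by linarith [hx.2]) _)

lemma mellinFun_add_nat (b : List Bool) (s : ℂ) (m : ℕ) {x : ℝ} (hx : x < 1) :
    mellinFun b (s + m) x = mellinFun b s x * ((1 - x : ℝ) : ℂ) ^ m := by
  have : ((1 - x : ℝ) : ℂ) ≠ 0 := Complex.ofReal_ne_zero.2 (by linarith)
  rw [mellinFun, mellinFun, mul_assoc, ← Complex.cpow_natCast, ← Complex.cpow_add _ _ this]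
  congr 2
  ring

/-- Every partial sum of ∑ (1 - x)^m is at most 1/x, and F_b(x)/x is still integrable against (1 -
x)^(s - 1). -/
lemma summable_mellinReal {b : List Bool} (hb : Admissible b) (hne : b ≠ []) {s : ℝ}
    (hs : 0 < s) : Summable fun m : ℕ => mellinReal b (s + m) := by
  have hre : 0 < (s : ℂ).re := hs
  refine summable_of_sum_range_le (c := ∫ x in Set.Ioo (0 : ℝ) 1, ‖mellinFun b s x / x‖)
    (fun m => mellinReal_nonneg hb _) fun n => ?_
  have e : ∀ m : ℕ, mellinReal b (s + m) = ∫ x in Set.Ioo (0 : ℝ) 1, ‖mellinFun b (s + m) x‖ :=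
    fun m => by rw [integral_norm_mellinFun hb]; simp
  have hint : ∀ m : ℕ, IntegrableOn (mellinFun b (s + m)) (Set.Ioo 0 1) := fun m =>
    integrableOn_mellinFun hb (by simp; positivity)
  simp only [e]
  rw [← integral_finsetSum _ fun m _ => (hint m).norm]
  refine setIntegral_mono_on (integrable_finsetSum _ fun m _ => (hint m).norm)
    (integrableOn_mellinFun_div hb hne hre).norm measurableSet_Ioo fun x hx => ?_
  have hx0 := hx.1
  have hx1 : 0 < 1 - x := by linarith [hx.2]
  have e2 : ∀ m : ℕ, ‖mellinFun b (s + m) x‖ = ‖mellinFun b s x‖ * (1 - x) ^ m := fun m => by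
    rw [mellinFun_add_nat b s m hx.2, norm_mul, norm_pow, Complex.norm_real,
      Real.norm_of_nonneg hx1.le]
  simp only [e2]
  rw [← Finset.mul_sum, norm_div, Complex.norm_real, Real.norm_of_nonneg hx0.le, div_eq_mul_inv]
  refine mul_le_mul_of_nonneg_left ?_ (norm_nonneg _)
  have hg := tsum_geometric_of_lt_one hx1.le (by linarith : 1 - x < 1)
  rw [sub_sub_cancel] at hg
  rw [← hg]
  exact (summable_geometric_of_lt_one hx1.le (by linarith)).sum_le_tsum _
    fun _ _ => by positivity

/-- Expand 1/x = ∑ (1 - x)^m and integrate term by term. -/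
lemma hasSum_mellin {b : List Bool} (hb : Admissible b) (hne : b ≠ []) {s : ℂ}
    (hs : 0 < s.re) : HasSum (fun m : ℕ => mellin b (s + m))
      (∫ x in Set.Ioo (0 : ℝ) 1, mellinFun b s x / x) := by
  have hint : ∀ m : ℕ, IntegrableOn (mellinFun b (s + m)) (Set.Ioo 0 1) := fun m =>
    integrableOn_mellinFun hb (by simp; positivity)
  have h := hasSum_integral_of_summable_integral_norm hint (by
    refine (summable_mellinReal hb hne hs).congr fun m => ?_
    rw [integral_norm_mellinFun hb]; simp)
  convert! h using 1
  refine setIntegral_congr_fun measurableSet_Ioo fun x hx => ?_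
  have hx0 := hx.1
  have hx1 : 0 < 1 - x := by linarith [hx.2]
  have e2 : ∀ m : ℕ, mellinFun b (s + m) x = mellinFun b s x * ((1 - x : ℝ) : ℂ) ^ m :=
    fun m => mellinFun_add_nat b s m hx.2
  simp only [e2]
  rw [tsum_mul_left, tsum_geometric_of_norm_lt_one, div_eq_mul_inv]
  · congr 2; push_cast; ring
  · rw [Complex.norm_real, Real.norm_of_nonneg hx1.le]; linarith

lemma mellin_nil {s : ℂ} (hs : 0 < s.re) : mellin [] s = 1 / s := by
  have h1 : mellin [] s = ∫ x in (0 : ℝ)..1, ((1 - x : ℝ) : ℂ) ^ (s - 1) := by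
    rw [mellin, intervalIntegral.integral_of_le zero_le_one, integral_Ioc_eq_integral_Ioo]
    simp only [mellinFun, pseries_landenCoeff_nil, Complex.ofReal_one, one_mul]
  have hs0 : s ≠ 0 := fun h => by simp [h] at hs
  rw [h1, intervalIntegral.integral_comp_sub_left (fun x : ℝ => (x : ℂ) ^ (s - 1)) 1, sub_self,
    sub_zero, integral_cpow (Or.inl (by simp; linarith)), sub_add_cancel, Complex.ofReal_zero,
    Complex.zero_cpow hs0, Complex.ofReal_one, Complex.one_cpow, sub_zero]

/-- Integration by parts. The boundary term vanishes at 0 because F does, and at 1 because F grows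
at most like (1 - x)^(-ε) with ε < Re s. -/
lemma integral_landenDeriv {a : Bool} {b : List Bool} (h : Admissible (a :: b)) {s : ℂ}
    (hs : 0 < s.re)
    (hint : IntegrableOn (fun x : ℝ => (landenDeriv a b x : ℂ) * ((1 - x : ℝ) : ℂ) ^ s)
      (Set.Ioo 0 1)) :
    mellin (a :: b) s
      = (∫ x in Set.Ioo (0 : ℝ) 1, (landenDeriv a b x : ℂ) * ((1 - x : ℝ) : ℂ) ^ s) / s := by
  have hs0 : s ≠ 0 := fun h => by simp [h] at hs
  have hM := integrableOn_mellinFun h hs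
  set F := pseries (landenCoeff (a :: b)) with hF
  have hderiv : ∀ x ∈ Set.Ioo (0 : ℝ) 1,
      HasDerivAt (fun x : ℝ => (F x : ℂ) * ((1 - x : ℝ) : ℂ) ^ s)
        ((landenDeriv a b x : ℂ) * ((1 - x : ℝ) : ℂ) ^ s - s * mellinFun (a :: b) s x) x := by
    intro x hx
    have d1 : HasDerivAt (fun x : ℝ => (F x : ℂ)) (landenDeriv a b x : ℂ) x :=
      (hasDerivAt_landen h hx).ofReal_comp
    have d0 : HasDerivAt (fun z : ℂ => 1 - z) (-1) x := by
      simpa using (hasDerivAt_id (x : ℂ)).const_sub 1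
    have hslit : 1 - (x : ℂ) ∈ Complex.slitPlane := by
      rw [← Complex.ofReal_one, ← Complex.ofReal_sub]
      exact Complex.ofReal_mem_slitPlane.2 (by linarith [hx.2])
    have d2 : HasDerivAt (fun x : ℝ => ((1 - x : ℝ) : ℂ) ^ s)
        (s * ((1 - x : ℝ) : ℂ) ^ (s - 1) * -1) x := by
      simpa using (d0.cpow_const (c := s) hslit).comp_ofReal
    refine (d1.mul d2).congr_deriv ?_
    rw [mellinFun]
    ring
  have hint' : IntervalIntegrable (fun x : ℝ =>
      (landenDeriv a b x : ℂ) * ((1 - x : ℝ) : ℂ) ^ s - s * mellinFun (a :: b) s x) volume 0 1 := by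
    rw [intervalIntegrable_iff_integrableOn_Ioo_of_le zero_le_one]
    exact hint.sub (hM.const_mul s)
  have hlim0 : Tendsto (fun x : ℝ => (F x : ℂ) * ((1 - x : ℝ) : ℂ) ^ s) (𝓝[>] 0) (𝓝 0) := by
    have hc : ContinuousAt (fun x : ℝ => (F x : ℂ) * ((1 - x : ℝ) : ℂ) ^ s) 0 :=
      (Complex.continuous_ofReal.continuousAt.comp
        (continuousAt_landen h ⟨le_rfl, one_pos⟩)).mul (continuousAt_one_sub_cpow one_pos s)
    have := hc.tendsto.mono_left (nhdsWithin_le_nhds (s := Set.Ioi 0))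
    simpa [hF, landenCoeff_zero (List.cons_ne_nil a b)] using this
  have hlim1 : Tendsto (fun x : ℝ => (F x : ℂ) * ((1 - x : ℝ) : ℂ) ^ s) (𝓝[<] 1) (𝓝 0) := by
    obtain ⟨ε, h0, h1, h2⟩ := exists_exponent hs
    obtain ⟨C, hC, hle⟩ := exists_pseries_landen_le h0 h1 h
    have hz : Tendsto (fun x : ℝ => C * (1 - x) ^ (s.re - ε)) (𝓝[<] 1) (𝓝 0) := by
      have hc : ContinuousAt (fun x : ℝ => C * (1 - x) ^ (s.re - ε)) 1 := by
        refine continuousAt_const.mul (ContinuousAt.rpow_const ?_ (Or.inr (by linarith)))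
        fun_prop
      have := hc.tendsto.mono_left (nhdsWithin_le_nhds (s := Set.Iio 1))
      simpa [Real.zero_rpow (by linarith : s.re - ε ≠ 0)] using this
    refine squeeze_zero_norm' ?_ hz
    filter_upwards [Ioo_mem_nhdsLT (zero_lt_one' ℝ)] with x hx
    have hx1 : 0 < 1 - x := by linarith [hx.2]
    have hx' := Set.Ioo_subset_Ico_self hx
    rw [norm_mul, norm_one_sub_cpow hx.2, Complex.norm_real,
      Real.norm_of_nonneg (pseries_landen_nonneg h x hx'), sub_eq_neg_add s.re, Real.rpow_add hx1,
      ← mul_assoc]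
    exact mul_le_mul_of_nonneg_right (hle x hx').1 (by positivity)
  have key := intervalIntegral.integral_eq_sub_of_hasDerivAt_of_tendsto one_pos hderiv hint'
    hlim0 hlim1
  rw [intervalIntegral.integral_of_le zero_le_one, integral_Ioc_eq_integral_Ioo, sub_zero,
    integral_sub hint (hM.const_mul s), integral_const_mul, sub_eq_zero] at key
  rw [key, mellin, mul_div_cancel_left₀ _ hs0]

lemma mellin_cons_true {b : List Bool} (hb : Admissible b) {s : ℂ} (hs : 0 < s.re) :
    mellin (true :: b) s = mellin b s / s := by
  have e : Set.EqOn (fun x : ℝ => (landenDeriv true b x : ℂ) * ((1 - x : ℝ) : ℂ) ^ s)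
      (mellinFun b s) (Set.Ioo 0 1) := by
    intro x hx
    have h1 : ((1 - x : ℝ) : ℂ) ≠ 0 := Complex.ofReal_ne_zero.2 (by linarith [hx.2])
    simp only [landenDeriv, mellinFun, if_true]
    rw [Complex.cpow_sub _ _ h1, Complex.cpow_one, Complex.ofReal_div]
    field_simp
  rw [integral_landenDeriv (a := true) (b := b) hb hs
    ((integrableOn_congr_fun e measurableSet_Ioo).2 (integrableOn_mellinFun hb hs)),
    setIntegral_congr_fun measurableSet_Ioo e, mellin]

lemma mellin_cons_false {b : List Bool} (hb : Admissible b) (hne : b ≠ []) {s : ℂ}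
    (hs : 0 < s.re) : mellin (false :: b) s = (∑' m : ℕ, mellin b (s + m)) / s := by
  have e : Set.EqOn (fun x : ℝ => (landenDeriv false b x : ℂ) * ((1 - x : ℝ) : ℂ) ^ s)
      (fun x => mellinFun b s x / x) (Set.Ioo 0 1) := by
    intro x hx
    have h1 : ((1 - x : ℝ) : ℂ) ≠ 0 := Complex.ofReal_ne_zero.2 (by linarith [hx.2])
    have h0 : (x : ℂ) ≠ 0 := Complex.ofReal_ne_zero.2 hx.1.ne'
    simp only [landenDeriv, mellinFun, Bool.false_eq_true, if_false]
    rw [Complex.cpow_sub _ _ h1, Complex.cpow_one, Complex.ofReal_div, Complex.ofReal_mul]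
    field_simp
  rw [integral_landenDeriv (a := false) (b := b) ⟨hne, hb⟩ hs
    ((integrableOn_congr_fun e measurableSet_Ioo).2 (integrableOn_mellinFun_div hb hne hs)),
    setIntegral_congr_fun measurableSet_Ioo e, (hasSum_mellin hb hne hs).tsum_eq]

/-! ### Truncated sums -/

/-- The nested sum of a word over indices from `j` to `N`. -/
def truncSum (α : ℂ) (N : ℕ) : List Bool → ℕ → ℂ
  | [], j => 1 / (j - α)
  | true :: b, j => truncSum α N b j / (j - α)
  | false :: b, j => (∑ m ∈ Finset.Ico j (N + 1), truncSum α N b m) / (j - α)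

lemma mellinReal_of_mellin {b c : List Bool} {s : ℝ} (h : mellin b s = mellin c s / s) :
    mellinReal b s = mellinReal c s / s := by
  rw [mellin_ofReal, mellin_ofReal] at h
  exact_mod_cast h

lemma sub_re_le_norm {α : ℂ} (hα : α.re < 1) {j : ℕ} (hj : 1 ≤ j) :
    0 < ((j : ℂ) - α).re ∧ (j : ℝ) - α.re ≤ ‖(j : ℂ) - α‖ := by
  have h1 : (1 : ℝ) ≤ j := by exact_mod_cast hj
  refine ⟨by simp; linarith, ?_⟩
  simpa using Complex.re_le_norm ((j : ℂ) - α)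

lemma norm_sum_Ico_le {f : ℕ → ℂ} {g : ℕ → ℝ} {j : ℕ} (hfg : ∀ m, j ≤ m → ‖f m‖ ≤ g m)
    (hg : Summable fun i => g (j + i)) (N : ℕ) :
    ‖∑ m ∈ Finset.Ico j N, f m‖ ≤ ∑' i, g (j + i) := by
  rw [Finset.sum_Ico_eq_sum_range]
  refine (norm_sum_le _ _).trans ((Finset.sum_le_sum fun i _ => hfg _ (Nat.le_add_right j i)).trans
    (hg.sum_le_tsum _ fun i _ => (norm_nonneg _).trans (hfg _ (Nat.le_add_right j i))))

/-- Dominated convergence in which both the summands and the range of summation depend on N. -/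
lemma tendsto_sum_Ico {f : ℕ → ℕ → ℂ} {h : ℕ → ℂ} {g : ℕ → ℝ} {j : ℕ}
    (hfg : ∀ N m, j ≤ m → ‖f N m‖ ≤ g m) (hg : Summable fun i => g (j + i))
    (hf : ∀ m, j ≤ m → Tendsto (fun N => f N m) atTop (𝓝 (h m))) :
    Tendsto (fun N => ∑ m ∈ Finset.Ico j (N + 1), f N m) atTop (𝓝 (∑' i, h (j + i))) := by
  have key := tendsto_tsum_of_dominated_convergence (𝓕 := atTop)
    (f := fun N i => if i < N + 1 - j then f N (j + i) else 0) (g := fun i => h (j + i)) hg ?_ ?_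
  · refine key.congr fun N => ?_
    rw [Finset.sum_Ico_eq_sum_range, tsum_eq_sum (s := Finset.range (N + 1 - j))]
    · exact Finset.sum_congr rfl fun i hi => if_pos (Finset.mem_range.1 hi)
    · exact fun i hi => if_neg (by simpa using hi)
  · intro i
    refine (hf (j + i) (Nat.le_add_right j i)).congr' ?_
    filter_upwards [eventually_ge_atTop (j + i)] with N hN
    rw [if_pos (by omega)]
  · refine Eventually.of_forall fun N i => ?_
    have := hfg N (j + i) (Nat.le_add_right j i)
    split_ifs
    · exact this
    · rw [norm_zero]; exact (norm_nonneg _).trans this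

/-- The truncated sums obey the recursion of the Mellin transforms with the infinite sum cut at N.
Since |j - α| ≥ j - Re α, they are dominated, uniformly in N, by the Mellin transform at the real
point j - Re α; this majorant is summable in j for nonempty words. -/
lemma truncSum_bound_and_tendsto {α : ℂ} (hα : α.re < 1) : ∀ {b : List Bool}, Admissible b →
    ∀ j : ℕ, 1 ≤ j → (∀ N, ‖truncSum α N b j‖ ≤ mellinReal b (j - α.re)) ∧
      Tendsto (fun N => truncSum α N b j) atTop (𝓝 (mellin b (j - α)))
  | [], _, j, hj => by
    obtain ⟨h1, h2⟩ := sub_re_le_norm hα hj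
    have h1' : 0 < (j : ℝ) - α.re := by simpa using h1
    refine ⟨fun N => ?_, ?_⟩
    · have e : mellinReal [] (j - α.re) = 1 / (j - α.re) := by
        have := mellin_nil (s := ((j - α.re : ℝ) : ℂ)) (by simpa using h1)
        rw [mellin_ofReal] at this
        exact_mod_cast this
      rw [truncSum, e, norm_div, norm_one]
      exact one_div_le_one_div_of_le h1' h2
    · rw [mellin_nil h1]
      exact tendsto_const_nhds
  | true :: b, h, j, hj => by
    obtain ⟨h1, h2⟩ := sub_re_le_norm hα hj
    have h1' : 0 < (j : ℝ) - α.re := by simpa using h1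
    have ih := truncSum_bound_and_tendsto hα (b := b) h j hj
    refine ⟨fun N => ?_, ?_⟩
    · rw [truncSum, mellinReal_of_mellin (mellin_cons_true (b := b) h (s := ((j - α.re : ℝ) : ℂ))
        (by simpa using h1)), norm_div]
      exact div_le_div₀ (mellinReal_nonneg (b := b) h _) (ih.1 N) h1' h2
    · rw [mellin_cons_true (b := b) h h1]
      exact ih.2.div_const _
  | false :: b, h, j, hj => by
    obtain ⟨h1, h2⟩ := sub_re_le_norm hα hj
    have h1' : 0 < (j : ℝ) - α.re := by simpa using h1
    have ih := fun m (hm : j ≤ m) => truncSum_bound_and_tendsto hα (b := b) h.2 m (hj.trans hm)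
    have hs : Summable fun i : ℕ => mellinReal b ((j + i : ℕ) - α.re) := by
      refine (summable_mellinReal h.2 h.1 h1').congr fun i => ?_
      congr 1; push_cast; ring
    refine ⟨fun N => ?_, ?_⟩
    · have e : mellinReal (false :: b) (j - α.re)
          = (∑' i : ℕ, mellinReal b ((j + i : ℕ) - α.re)) / (j - α.re) := by
        have := mellin_cons_false h.2 h.1 (s := ((j - α.re : ℝ) : ℂ)) (by simpa using h1)
        have e2 : ∀ i : ℕ, mellin b (((j - α.re : ℝ) : ℂ) + i)
            = (mellinReal b ((j + i : ℕ) - α.re) : ℂ) := fun i => by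
          rw [← mellin_ofReal]; congr 1; push_cast; ring
        simp only [e2] at this
        rw [mellin_ofReal, ← Complex.ofReal_tsum] at this
        exact_mod_cast this
      rw [truncSum, e, norm_div]
      exact div_le_div₀ (tsum_nonneg fun i => mellinReal_nonneg h.2 _)
        (norm_sum_Ico_le (g := fun m => mellinReal b (m - α.re)) (fun m hm => (ih m hm).1 N) hs _)
        h1' h2
    · rw [mellin_cons_false h.2 h.1 h1]
      have key := tendsto_sum_Ico (f := fun N m => truncSum α N b m)
        (h := fun m => mellin b (m - α)) (g := fun m => mellinReal b (m - α.re))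
        (fun N m hm => (ih m hm).1 N) hs (fun m hm => (ih m hm).2)
      have e : ∀ i : ℕ, mellin b ((j + i : ℕ) - α) = mellin b (j - α + i) := fun i => by
        congr 1; push_cast; ring
      simp only [e] at key
      exact key.div_const _

lemma tendsto_sum_truncSum {α : ℂ} (hα : α.re < 1) {b : List Bool} (hb : Admissible b)
    (hne : b ≠ []) : Tendsto (fun N => ∑ j ∈ Finset.Ico 1 (N + 1), truncSum α N b j) atTop
      (𝓝 (∫ x in Set.Ioo (0 : ℝ) 1, mellinFun b (1 - α) x / x)) := by
  have hs : Summable fun i : ℕ => mellinReal b ((1 + i : ℕ) - α.re) := by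
    refine (summable_mellinReal hb hne (sub_pos.2 hα)).congr fun i => ?_
    congr 1; push_cast; ring
  have key := tendsto_sum_Ico (f := fun N m => truncSum α N b m)
    (h := fun m => mellin b (m - α)) (g := fun m => mellinReal b (m - α.re)) (j := 1)
    (fun N m hm => (truncSum_bound_and_tendsto hα hb m hm).1 N) hs
    (fun m hm => (truncSum_bound_and_tendsto hα hb m hm).2)
  have e : ∀ i : ℕ, mellin b ((1 + i : ℕ) - α) = mellin b (1 - α + i) := fun i => by
    congr 1; push_cast; ring
  simp only [e] at key
  rwa [(hasSum_mellin hb hne (s := 1 - α) (by simpa using hα)).tsum_eq] at key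

/-! ### Star sums as nested sums -/

/-- The star sum of a list of exponents. -/
def starList (α : ℂ) : List ℕ → ℕ → ℂ
  | [] => fun _ => 1
  | k :: ks => fun N => ∑ m ∈ Finset.Icc 1 N, 1 / ((m : ℂ) - α) ^ k * starList α ks m

lemma antitone_cons {r n : ℕ} {p : Fin r → ℕ} :
    (∀ i j, i ≤ j → (Fin.cons n p : Fin (r + 1) → ℕ) j ≤ (Fin.cons n p : Fin (r + 1) → ℕ) i) ↔
      (∀ i, p i ≤ n) ∧ ∀ i j, i ≤ j → p j ≤ p i := by
  refine ⟨fun h => ⟨fun i => ?_, fun i j hij => ?_⟩, fun h i j hij => ?_⟩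
  · simpa using h 0 i.succ (Fin.zero_le _)
  · simpa using h i.succ j.succ (Fin.succ_le_succ_iff.2 hij)
  · induction i using Fin.cases with
    | zero =>
      induction j using Fin.cases with
      | zero => exact le_rfl
      | succ j => simpa using h.1 j
    | succ i =>
      induction j using Fin.cases with
      | zero => exact absurd hij (not_le.2 (Fin.succ_pos i))
      | succ j => simpa using h.2 i j (Fin.succ_le_succ_iff.1 hij)

lemma zetaStarSum_eq_starList (α : ℂ) : ∀ {r : ℕ} (k : Fin r → ℕ) (N : ℕ),
    zetaStarSum k (1 - α) N = starList α (List.ofFn k) N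
  | 0, k, N => by simp [zetaStarSum, starList]
  | r + 1, k, N => by
    have h1 : zetaStarSum k (1 - α) N = ∑ q ∈ (Finset.Icc 1 N).sigma fun n =>
        (Fintype.piFinset fun _ : Fin r => Finset.Icc 1 n).filter
          fun m => ∀ i j, i ≤ j → m j ≤ m i,
        1 / ((q.1 : ℂ) - α) ^ k 0 * ∏ i, 1 / ((q.2 i : ℂ) + (1 - α) - 1) ^ k i.succ := by
      refine Finset.sum_bij' (fun p _ => ⟨p 0, Fin.tail p⟩)
        (fun q _ => (Fin.cons q.1 q.2 : Fin (r + 1) → ℕ)) ?_ ?_ ?_ ?_ ?_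
      · intro p hp
        rw [← Fin.cons_self_tail p, Finset.mem_filter, antitone_cons, Fintype.mem_piFinset,
          Fin.forall_fin_succ] at hp
        simp only [Fin.cons_zero, Fin.cons_succ, Finset.mem_Icc] at hp
        simp only [Finset.mem_sigma, Finset.mem_filter, Fintype.mem_piFinset, Finset.mem_Icc]
        exact ⟨hp.1.1, fun i => ⟨(hp.1.2 i).1, hp.2.1 i⟩, hp.2.2⟩
      · rintro ⟨n, q⟩ hq
        simp only [Finset.mem_sigma, Finset.mem_filter, Fintype.mem_piFinset, Finset.mem_Icc] at hq
        rw [Finset.mem_filter, antitone_cons, Fintype.mem_piFinset, Fin.forall_fin_succ]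
        simp only [Fin.cons_zero, Fin.cons_succ, Finset.mem_Icc]
        exact ⟨⟨hq.1, fun i => ⟨(hq.2.1 i).1, (hq.2.1 i).2.trans hq.1.2⟩⟩,
          fun i => (hq.2.1 i).2, hq.2.2⟩
      · intro p _
        exact Fin.cons_self_tail p
      · rintro ⟨n, q⟩ _
        simp
      · intro p _
        rw [Fin.prod_univ_succ]
        congr 3
        ring
    rw [h1, Finset.sum_sigma, List.ofFn_succ, starList]
    refine Finset.sum_congr rfl fun n _ => ?_
    dsimp only
    rw [← Finset.mul_sum, ← zetaStarSum_eq_starList α _ n, zetaStarSum]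

/-- One step in the passage from a word to the exponents of the star sum. -/
def dualStep (st : ℕ × List ℕ) (a : Bool) : ℕ × List ℕ :=
  if a then (st.1 + 1, st.2) else (0, (st.1 + 1) :: st.2)

/-- The state records what has been read: `st.1` is the exponent gathered so far at the current
index j, and `st.2` lists the exponents of the smaller indices, already summed. Each letter releases
one factor 1/(j - α), and the empty word releases the final one, hence the + 1. -/
lemma sum_truncSum_eq (α : ℂ) (N : ℕ) : ∀ (b : List Bool) (st : ℕ × List ℕ),
    ∑ j ∈ Finset.Icc 1 N, 1 / ((j : ℂ) - α) ^ st.1 * starList α st.2 j * truncSum α N b j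
      = starList α (((b.foldl dualStep st).1 + 1) :: (b.foldl dualStep st).2) N
  | [], st => by
    rw [List.foldl_nil, starList]
    refine Finset.sum_congr rfl fun j _ => ?_
    rw [truncSum, pow_succ, one_div_mul_eq_div, one_div_mul_eq_div, ← div_div]
    ring
  | true :: b, st => by
    rw [List.foldl_cons, ← sum_truncSum_eq α N b]
    refine Finset.sum_congr rfl fun j _ => ?_
    rw [truncSum, dualStep, if_pos rfl, pow_succ, ← div_div]
    ring
  | false :: b, st => by
    rw [List.foldl_cons, ← sum_truncSum_eq α N b]
    have h1 : ∀ j ∈ Finset.Icc 1 N,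
        1 / ((j : ℂ) - α) ^ st.1 * starList α st.2 j * truncSum α N (false :: b) j
        = ∑ m ∈ Finset.Ico j (N + 1),
          1 / ((j : ℂ) - α) ^ (st.1 + 1) * starList α st.2 j * truncSum α N b m := by
      intro j _
      rw [truncSum, ← Finset.mul_sum, pow_succ, ← div_div]
      ring
    -- Exchanging the sums over j ≤ m turns the sum over j into a completed star sum up to m.
    rw [Finset.sum_congr rfl h1, Finset.sum_comm' (t' := Finset.Icc 1 N)
      (s' := fun m => Finset.Icc 1 m)
      (fun j m => by simp only [Finset.mem_Icc, Finset.mem_Ico]; omega)]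
    refine Finset.sum_congr rfl fun m _ => ?_
    rw [← Finset.sum_mul, dualStep, if_neg (by decide), starList]
    simp

/-! ### Hoffman duality on words -/

/-- `n` is a sum of an initial segment of `l`. -/
def IsPrefixSum (l : List ℕ) (n : ℕ) : Prop := ∃ l₁ l₂, l = l₁ ++ l₂ ∧ l₁.sum = n

/-- `n` is a sum of a final segment of `l`. -/
def IsSuffixSum (l : List ℕ) (n : ℕ) : Prop := ∃ l₁ l₂, l = l₁ ++ l₂ ∧ l₂.sum = n

lemma isPrefixSum_reverse {l : List ℕ} {n : ℕ} : IsPrefixSum l.reverse n ↔ IsSuffixSum l n := by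
  constructor
  · rintro ⟨l₁, l₂, h, hs⟩
    refine ⟨l₂.reverse, l₁.reverse, ?_, by rw [List.sum_reverse, hs]⟩
    rw [← List.reverse_append, ← h, List.reverse_reverse]
  · rintro ⟨l₁, l₂, rfl, hs⟩
    exact ⟨l₂.reverse, l₁.reverse, List.reverse_append, by rw [List.sum_reverse, hs]⟩

lemma isPrefixSum_iff_isSuffixSum {l : List ℕ} {m n : ℕ} (h : m + n = l.sum) :
    IsPrefixSum l m ↔ IsSuffixSum l n := by
  constructor <;> rintro ⟨l₁, l₂, rfl, hs⟩ <;> rw [List.sum_append] at h <;>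
    exact ⟨l₁, l₂, rfl, by omega⟩

lemma isSuffixSum_cons {k : ℕ} {ks : List ℕ} {n : ℕ} :
    IsSuffixSum (k :: ks) n ↔ n = k + ks.sum ∨ IsSuffixSum ks n := by
  constructor
  · rintro ⟨l₁, l₂, h, hs⟩
    rcases List.cons_eq_append_iff.1 h with ⟨rfl, rfl⟩ | ⟨l₃, rfl, rfl⟩
    · left; rw [← hs, List.sum_cons]
    · exact Or.inr ⟨l₃, l₂, rfl, hs⟩
  · rintro (rfl | ⟨l₁, l₂, rfl, hs⟩)
    · exact ⟨[], k :: ks, rfl, List.sum_cons⟩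
    · exact ⟨k :: l₁, l₂, rfl, hs⟩

lemma IsSuffixSum.le {l : List ℕ} {n : ℕ} (h : IsSuffixSum l n) : n ≤ l.sum := by
  obtain ⟨l₁, l₂, rfl, rfl⟩ := h
  rw [List.sum_append]; omega

lemma isPrefixSum_cons {k : ℕ} {ks : List ℕ} {n : ℕ} (hn : 0 < n) :
    IsPrefixSum (k :: ks) n ↔ ∃ m, n = k + m ∧ IsPrefixSum ks m := by
  constructor
  · rintro ⟨l₁, l₂, h, hs⟩
    rcases List.cons_eq_append_iff.1 h with ⟨rfl, rfl⟩ | ⟨l₃, rfl, rfl⟩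
    · simp at hs; omega
    · exact ⟨l₃.sum, by rw [← hs, List.sum_cons], l₃, l₂, rfl, rfl⟩
  · rintro ⟨m, rfl, l₁, l₂, rfl, hs⟩
    exact ⟨k :: l₁, l₂, rfl, by rw [List.sum_cons, hs]⟩

lemma length_wordOf : ∀ {l : List ℕ}, (∀ k ∈ l, 0 < k) → (wordOf l).length = l.sum
  | [], _ => rfl
  | k :: ks, h => by
    have hk := h k List.mem_cons_self
    rw [wordOf, List.length_append, List.length_replicate, List.length_cons, List.sum_cons,
      length_wordOf fun k hk => h k (List.mem_cons_of_mem _ hk)]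
    omega

/-- A part k becomes k letters, the last of which is `true`, so the letters `true` mark the ends of
the blocks. -/
lemma getElem?_wordOf : ∀ {l : List ℕ}, (∀ k ∈ l, 0 < k) → ∀ n : ℕ,
    (wordOf l)[n]? = some true ↔ IsPrefixSum l (n + 1)
  | [], _, n => by
    simp only [wordOf, List.getElem?_nil, reduceCtorEq, false_iff]
    rintro ⟨l₁, l₂, h, hs⟩
    rw [(List.append_eq_nil_iff.1 h.symm).1] at hs
    simp at hs
  | k :: ks, h, n => by
    have hk := h k List.mem_cons_self
    have ih := getElem?_wordOf fun k hk => h k (List.mem_cons_of_mem _ hk)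
    rw [isPrefixSum_cons n.succ_pos, wordOf, List.getElem?_append, List.length_replicate]
    split_ifs with hn
    · rw [List.getElem?_replicate_of_lt hn]
      simp only [Option.some.injEq, Bool.false_eq_true, false_iff]
      rintro ⟨m, hm, -⟩
      omega
    · rcases Nat.eq_zero_or_pos (n - (k - 1)) with h0 | h0
      · rw [h0, List.getElem?_cons_zero]
        simp only [true_iff]
        exact ⟨0, by omega, [], ks, rfl, rfl⟩
      · obtain ⟨m, hm⟩ := Nat.exists_eq_add_of_lt h0
        rw [show n - (k - 1) = m + 1 by omega, List.getElem?_cons_succ, ih]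
        constructor
        · exact fun h => ⟨m + 1, by omega, h⟩
        · rintro ⟨m', hm', h⟩
          rwa [show m + 1 = m' by omega]

/-- Each `false` closes a block counting the letters since the previous `false`, and `st.1` counts
the trailing letters `true`. Blocks are prepended, so the positions of `false` appear as sums of
final segments. -/
lemma foldl_dualStep_spec (b : List Bool) :
    (b.foldl dualStep (0, [])).1 + (b.foldl dualStep (0, [])).2.sum = b.length ∧
    (∀ k ∈ (b.foldl dualStep (0, [])).2, 0 < k) ∧
    ∀ n < b.length, IsSuffixSum (b.foldl dualStep (0, [])).2 (n + 1) ↔ b[n]? = some false := by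
  induction b using List.reverseRecOn with
  | nil => simp
  | append_singleton b a ih =>
    rw [List.foldl_concat]
    obtain ⟨h1, h2, h3⟩ := ih
    set st := b.foldl dualStep (0, []) with hst
    rw [List.length_append, List.length_singleton]
    have hlast : (b ++ [a])[b.length]? = some a := List.getElem?_concat_length
    cases a with
    | true =>
      simp only [dualStep, if_true]
      refine ⟨by omega, h2, fun n hn => ?_⟩
      rcases (Nat.lt_succ_iff.1 hn).eq_or_lt with rfl | hn
      · rw [hlast]
        simp only [Option.some.injEq, Bool.true_eq_false, iff_false]
        intro h
        have := h.le
        omega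
      · rw [h3 n hn, List.getElem?_append_left hn]
    | false =>
      simp only [dualStep, Bool.false_eq_true, if_false]
      refine ⟨by rw [List.sum_cons]; omega, ?_, fun n hn => ?_⟩
      · intro k hk
        rcases List.mem_cons.1 hk with rfl | hk
        · omega
        · exact h2 k hk
      · rw [isSuffixSum_cons]
        rcases (Nat.lt_succ_iff.1 hn).eq_or_lt with rfl | hn
        · rw [hlast]
          simp only [iff_true]
          left; omega
        · rw [h3 n hn, List.getElem?_append_left hn, or_iff_right]
          omega

lemma exists_wordOf_eq_append {l : List ℕ} (hl : l ≠ []) : ∃ b, wordOf l = b ++ [true] := by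
  induction l with
  | nil => exact absurd rfl hl
  | cons k ks ih =>
    rcases eq_or_ne ks [] with rfl | hks
    · exact ⟨List.replicate (k - 1) false, rfl⟩
    · obtain ⟨b, hb⟩ := ih hks
      exact ⟨List.replicate (k - 1) false ++ true :: b, by simp [wordOf, hb]⟩

lemma mem_compositionAsSetEquiv {w : ℕ} (c : Composition w) (i : Fin (w - 1)) :
    i ∈ compositionAsSetEquiv w (compositionEquiv w c) ↔ IsPrefixSum c.blocks (i + 1) := by
  have h1 : i ∈ compositionAsSetEquiv w (compositionEquiv w c) ↔
      (⟨1 + (i : ℕ), by omega⟩ : Fin w.succ) ∈ c.boundaries := by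
    simp [compositionAsSetEquiv, compositionEquiv, Composition.toCompositionAsSet]
  rw [h1, Composition.boundaries, Finset.mem_map]
  constructor
  · rintro ⟨j, -, hj⟩
    refine ⟨c.blocks.take j, c.blocks.drop j, (List.take_append_drop _ _).symm, ?_⟩
    have := congrArg Fin.val hj
    simp only [Composition.boundary] at this
    exact this.trans (add_comm _ _)
  · rintro ⟨l₁, l₂, h, hs⟩
    have hlen : l₁.length < c.length + 1 := by
      rw [← c.blocks_length, h, List.length_append]; omega
    refine ⟨⟨l₁.length, hlen⟩, Finset.mem_univ _, Fin.ext ?_⟩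
    show c.sizeUpTo l₁.length = 1 + (i : ℕ)
    rw [Composition.sizeUpTo, h, List.take_left, hs, add_comm]

/-- Without its last letter, always `true`, the word has w - 1 letters, one for each possible proper
partial sum; `true` marks those of k and `false` those of the dual, so the two sets are
complementary. The deleted letter accounts for the increase of the first exponent. -/
lemma plusFirst_hoffmanDual_reverse {w : ℕ} (hw : 0 < w) (k : Composition w) :
    List.ofFn (plusFirst (hoffmanDual k.reverse).blocksFun)
      = (((wordOf k.blocks).foldl dualStep (0, [])).1 + 1) ::
        ((wordOf k.blocks).foldl dualStep (0, [])).2 := by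
  have hpos : ∀ j ∈ k.blocks, 0 < j := fun _ h => k.blocks_pos h
  have hne : k.blocks ≠ [] := by
    intro h
    have := k.blocks_sum
    rw [h] at this
    simp at this
    omega
  obtain ⟨b, hb⟩ := exists_wordOf_eq_append hne
  have hlen := length_wordOf hpos
  rw [k.blocks_sum, hb, List.length_append, List.length_singleton] at hlen
  have hget := getElem?_wordOf hpos
  obtain ⟨h1, h2, h3⟩ := foldl_dualStep_spec b
  rw [hb, List.foldl_concat]
  rw [hb] at hget
  set st := b.foldl dualStep (0, []) with hst
  let D : Composition w :=
    { blocks := (st.1 + 1) :: st.2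
      blocks_pos := by
        intro i hi
        rcases List.mem_cons.1 hi with rfl | hi
        · omega
        · exact h2 i hi
      blocks_sum := by rw [List.sum_cons]; omega }
  have hD : hoffmanDual k.reverse = D := by
    rw [hoffmanDual, Equiv.symm_apply_eq, Equiv.symm_apply_eq]
    ext i
    have hi := i.2
    -- The index i stands for the number i + 1; reversal replaces it by w - 1 - i, which is the
    -- letter at position w - 2 - i.
    have e' : IsPrefixSum D.blocks (i + 1) ↔ b[w - 2 - (i : ℕ)]? = some false := by
      rw [isPrefixSum_iff_isSuffixSum (n := w - 2 - i + 1) (by rw [D.blocks_sum]; omega),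
        isSuffixSum_cons, or_iff_right (by omega), h3 _ (by omega)]
    have e : IsPrefixSum k.reverse.blocks (i + 1) ↔ b[w - 2 - (i : ℕ)]? = some true := by
      rw [← List.getElem?_append_left (l₂ := [true]) (by omega : w - 2 - (i : ℕ) < b.length), hget,
        isPrefixSum_iff_isSuffixSum (l := k.blocks) (n := i + 1) (by rw [k.blocks_sum]; omega)]
      exact isPrefixSum_reverse
    rw [Finset.mem_compl, mem_compositionAsSetEquiv, mem_compositionAsSetEquiv, e, e',
      List.getElem?_eq_getElem (by omega)]
    cases b[w - 2 - (i : ℕ)] <;> simp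
  rw [hD]
  have hplus : ∀ {r : ℕ} (f : Fin r → ℕ) {a : ℕ} {l : List ℕ}, List.ofFn f = a :: l →
      List.ofFn (plusFirst f) = (a + 1) :: l := by
    intro r f a l h
    cases r with
    | zero => simp at h
    | succ r =>
      rw [List.ofFn_succ, List.cons.injEq] at h
      rw [List.ofFn_succ, ← h.1, ← h.2]
      simp [plusFirst]
  rw [hplus D.blocksFun (a := st.1 + 1) (l := st.2) D.ofFn_blocksFun]
  rfl

/-! ### Locally uniform convergence of star sums -/

lemma exists_ball_norm_inv_le {α₀ : ℂ} (h : α₀ ∈ complexMinusPosInt) :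
    ∃ δ > 0, ∃ B : ℝ, 1 ≤ B ∧ ∀ α ∈ Metric.ball α₀ δ, ∀ m : ℕ, 1 ≤ m →
      (m : ℂ) - α ≠ 0 ∧ ‖1 / ((m : ℂ) - α)‖ ≤ B / m := by
  -- Convergence of m/(m - α₀) bounds this ratio for all m ≥ 1 at once.
  have hlim : Tendsto (fun m : ℕ => ((m : ℂ) / ((m : ℂ) + -α₀))) atTop (𝓝 1) :=
    tendsto_natCast_div_add_atTop (-α₀)
  obtain ⟨C, hC⟩ := hlim.norm.bddAbove_range
  have hC' : ∀ m : ℕ, 1 ≤ m → (m : ℝ) ≤ max C 1 * ‖(m : ℂ) - α₀‖ := by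
    intro m hm
    have h0 : (m : ℂ) - α₀ ≠ 0 := fun h' => h m hm (sub_eq_zero.1 h').symm
    have h1 := hC ⟨m, rfl⟩
    simp only [← sub_eq_add_neg, norm_div, Complex.norm_natCast] at h1
    rw [div_le_iff₀ (norm_pos_iff.2 h0)] at h1
    exact h1.trans (mul_le_mul_of_nonneg_right (le_max_left _ _) (norm_nonneg _))
  set K := max C 1 with hK
  have hK1 : 1 ≤ K := le_max_right _ _
  -- With m ≤ K|m - α₀|, moving α₀ by less than 1/(2K) costs at most 1/2 ≤ m/2, hence m ≤ 2K|m - α|.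
  refine ⟨1 / (2 * K), by positivity, 2 * K, by linarith, fun α hα m hm => ?_⟩
  have hm1 : (1 : ℝ) ≤ m := by exact_mod_cast hm
  have h1 := hC' m hm
  have h2 : ‖(m : ℂ) - α₀‖ ≤ ‖(m : ℂ) - α‖ + ‖α - α₀‖ := by
    have := norm_add_le ((m : ℂ) - α) (α - α₀)
    rwa [sub_add_sub_cancel] at this
  have h3 : ‖α - α₀‖ < 1 / (2 * K) := by rwa [mem_ball_iff_norm] at hα
  have h4 : K * ‖α - α₀‖ ≤ 1 / 2 := by
    calc K * ‖α - α₀‖ ≤ K * (1 / (2 * K)) := by gcongr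
      _ = 1 / 2 := by field_simp
  have h5 : (m : ℝ) ≤ 2 * K * ‖(m : ℂ) - α‖ := by nlinarith
  have h6 : 0 < ‖(m : ℂ) - α‖ := by
    by_contra hc
    have : ‖(m : ℂ) - α‖ = 0 := le_antisymm (not_lt.1 hc) (norm_nonneg _)
    rw [this] at h5
    linarith
  refine ⟨norm_pos_iff.1 h6, ?_⟩
  rw [norm_div, norm_one, div_le_div_iff₀ h6 (by linarith)]
  linarith

lemma isOpen_complexMinusPosInt : IsOpen complexMinusPosInt := by
  rw [Metric.isOpen_iff]
  intro α₀ h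
  obtain ⟨δ, hδ, B, -, hB⟩ := exists_ball_norm_inv_le h
  refine ⟨δ, hδ, fun α hα n hn heq => (hB α hα n hn).1 ?_⟩
  rw [heq, sub_self]

/-- Telescoping, from 1/√(n + 1) ≤ 2√(n + 1) - 2√n. -/
lemma sum_inv_sqrt_le (N : ℕ) :
    ∑ m ∈ Finset.Icc 1 N, 1 / (m : ℝ) * √m ≤ 2 * √N := by
  induction N with
  | zero => simp
  | succ n ih =>
    rw [Finset.sum_Icc_succ_top (by omega)]
    have ha : 0 ≤ √(n : ℝ) := Real.sqrt_nonneg _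
    have hb : 0 < √((n + 1 : ℕ) : ℝ) := Real.sqrt_pos.2 (by positivity)
    have ha2 : √(n : ℝ) ^ 2 = n := Real.sq_sqrt (by positivity)
    have hb2 : √((n + 1 : ℕ) : ℝ) ^ 2 = n + 1 := by
      rw [Real.sq_sqrt (by positivity)]; push_cast; ring
    have e : 1 / ((n + 1 : ℕ) : ℝ) * √((n + 1 : ℕ) : ℝ) = 1 / √((n + 1 : ℕ) : ℝ) := by
      have : ((n + 1 : ℕ) : ℝ) = √((n + 1 : ℕ) : ℝ) ^ 2 := by rw [hb2]; push_cast; ring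
      nth_rewrite 1 [this]
      field_simp
    rw [e]
    have : 1 / √((n + 1 : ℕ) : ℝ) ≤ 2 * √((n + 1 : ℕ) : ℝ) - 2 * √(n : ℝ) := by
      rw [div_le_iff₀ hb]
      nlinarith [sq_nonneg (√((n + 1 : ℕ) : ℝ) - √(n : ℝ))]
    linarith

/-- A crude bound by √N reproduces itself at each layer at the cost of a factor 2, and is small
enough to be summable against m^(-2). -/
lemma norm_starList_le {α : ℂ} {B : ℝ} (hB : 1 ≤ B)
    (h : ∀ m : ℕ, 1 ≤ m → ‖1 / ((m : ℂ) - α)‖ ≤ B / m) :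
    ∀ {l : List ℕ}, (∀ k ∈ l, 0 < k) → ∀ N : ℕ, 1 ≤ N →
      ‖starList α l N‖ ≤ B ^ l.sum * 2 ^ l.length * √N
  | [], _, N, hN => by
    have : (1 : ℝ) ≤ N := by exact_mod_cast hN
    simpa [starList] using this
  | k :: ks, hl, N, _ => by
    have hk := hl k List.mem_cons_self
    have ih := norm_starList_le hB h (l := ks) fun k hk => hl k (List.mem_cons_of_mem _ hk)
    have hterm : ∀ m ∈ Finset.Icc 1 N, ‖1 / ((m : ℂ) - α) ^ k * starList α ks m‖
        ≤ B ^ k * (B ^ ks.sum * 2 ^ ks.length) * (1 / (m : ℝ) * √m) := by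
      intro m hm
      have hm1 := (Finset.mem_Icc.1 hm).1
      have hm2 : (1 : ℝ) ≤ m := by exact_mod_cast hm1
      have h1 : ‖1 / ((m : ℂ) - α) ^ k‖ ≤ B ^ k * (1 / m) := by
        rw [← one_div_pow, norm_pow]
        refine (pow_le_pow_left₀ (norm_nonneg _) (h m hm1) k).trans ?_
        rw [div_pow, div_eq_mul_one_div]
        gcongr
        exact le_self_pow₀ hm2 hk.ne'
      rw [norm_mul]
      calc _ ≤ B ^ k * (1 / m) * (B ^ ks.sum * 2 ^ ks.length * √m) :=
            mul_le_mul h1 (ih m hm1) (norm_nonneg _) (by positivity)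
        _ = _ := by ring
    rw [starList]
    refine (norm_sum_le _ _).trans ((Finset.sum_le_sum hterm).trans ?_)
    rw [← Finset.mul_sum]
    refine (mul_le_mul_of_nonneg_left (sum_inv_sqrt_le N) (by positivity)).trans_eq ?_
    rw [List.sum_cons, List.length_cons, pow_add, pow_succ]
    ring

lemma starList_cons_eq_range (α : ℂ) (k : ℕ) (ks : List ℕ) (N : ℕ) :
    starList α (k :: ks) N
      = ∑ i ∈ Finset.range N, 1 / (((i + 1 : ℕ) : ℂ) - α) ^ k * starList α ks (i + 1) := by
  rw [Finset.range_eq_Ico,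
    Finset.sum_Ico_add' (fun m : ℕ => 1 / ((m : ℂ) - α) ^ k * starList α ks m) 0 N 1]
  rfl

/-- Weierstrass M-test: near α₀ the terms are O(m^(-2) · √m) = O(m^(-3/2)). -/
lemma exists_tendstoUniformlyOn_starList {k : ℕ} {ks : List ℕ} (hk : 2 ≤ k)
    (hks : ∀ j ∈ ks, 0 < j) {α₀ : ℂ} (h : α₀ ∈ complexMinusPosInt) : ∃ δ > 0,
    TendstoUniformlyOn (fun N α => starList α (k :: ks) N)
      (fun α => ∑' i : ℕ, 1 / (((i + 1 : ℕ) : ℂ) - α) ^ k * starList α ks (i + 1)) atTop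
      (Metric.ball α₀ δ) := by
  obtain ⟨δ, hδ, B, hB1, hB⟩ := exists_ball_norm_inv_le h
  refine ⟨δ, hδ, ?_⟩
  simp only [starList_cons_eq_range]
  set D := B ^ k * (B ^ ks.sum * 2 ^ ks.length) with hD
  refine tendstoUniformlyOn_tsum_nat (u := fun i => D * ((i + 1 : ℕ) : ℝ) ^ (-(3 / 2) : ℝ))
    ?_ fun i α hα => ?_
  · refine Summable.mul_left _ ?_
    have := Real.summable_nat_rpow.2 (by norm_num : (-(3 / 2) : ℝ) < -1)
    exact (summable_nat_add_iff 1).2 this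
  · have hi : (1 : ℝ) ≤ ((i + 1 : ℕ) : ℝ) := by push_cast; linarith [i.cast_nonneg (α := ℝ)]
    set m := i + 1 with hm
    have h1 : ‖1 / ((m : ℂ) - α) ^ k‖ ≤ B ^ k * (1 / (m : ℝ) ^ 2) := by
      rw [← one_div_pow, norm_pow]
      refine (pow_le_pow_left₀ (norm_nonneg _) (hB α hα m (by omega)).2 k).trans ?_
      rw [div_pow, div_eq_mul_one_div]
      gcongr
    have h2 := norm_starList_le hB1 (fun m hm => (hB α hα m hm).2) hks m (by omega)
    rw [norm_mul]
    have h3 : (m : ℝ) ^ (-(3 / 2) : ℝ) = 1 / (m : ℝ) ^ 2 * √m := by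
      have hm0 : (0 : ℝ) < m := by linarith
      rw [Real.sqrt_eq_rpow, one_div, ← Real.rpow_natCast, ← Real.rpow_neg hm0.le,
        ← Real.rpow_add hm0]
      norm_num
    rw [h3]
    calc _ ≤ B ^ k * (1 / (m : ℝ) ^ 2) * (B ^ ks.sum * 2 ^ ks.length * √m) :=
          mul_le_mul h1 h2 (norm_nonneg _) (by positivity)
      _ = _ := by rw [hD]; ring

lemma differentiableAt_starList {α : ℂ} (h : α ∈ complexMinusPosInt) :
    ∀ (l : List ℕ) (N : ℕ), DifferentiableAt ℂ (fun α => starList α l N) α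
  | [], _ => differentiableAt_const _
  | k :: ks, N => by
    simp only [starList]
    refine DifferentiableAt.fun_sum fun m hm => ?_
    have h0 : (m : ℂ) - α ≠ 0 := fun h' =>
      h m (Finset.mem_Icc.1 hm).1 (sub_eq_zero.1 h').symm
    refine DifferentiableAt.fun_mul ?_ (differentiableAt_starList h ks m)
    refine (differentiableAt_const _).fun_div ?_ (pow_ne_zero _ h0)
    fun_prop

lemma exists_differentiableOn_tendsto_starList {k : ℕ} {ks : List ℕ} (hk : 2 ≤ k)
    (hks : ∀ j ∈ ks, 0 < j) : ∃ I : ℂ → ℂ, DifferentiableOn ℂ I complexMinusPosInt ∧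
      ∀ α ∈ complexMinusPosInt, Tendsto (starList α (k :: ks)) atTop (𝓝 (I α)) := by
  refine ⟨fun α => ∑' i : ℕ, 1 / (((i + 1 : ℕ) : ℂ) - α) ^ k * starList α ks (i + 1), ?_, ?_⟩
  · refine TendstoLocallyUniformlyOn.differentiableOn (φ := atTop)
      (F := fun N α => starList α (k :: ks) N) ?_ ?_ isOpen_complexMinusPosInt
    · refine tendstoLocallyUniformlyOn_of_forall_exists_nhds fun α hα => ?_
      obtain ⟨δ, hδ, hu⟩ := exists_tendstoUniformlyOn_starList hk hks hα
      exact ⟨Metric.ball α δ, mem_nhdsWithin_of_mem_nhds (Metric.ball_mem_nhds α hδ), hu⟩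
    · exact Eventually.of_forall fun N α hα =>
        (differentiableAt_starList hα (k :: ks) N).differentiableWithinAt
  · intro α hα
    obtain ⟨δ, hδ, hu⟩ := exists_tendstoUniformlyOn_starList hk hks hα
    exact hu.tendsto_at (Metric.mem_ball_self hδ)

end HurwitzMZV

end

/-! ### Proof of the theorem: the identity for Re α < 1 and its continuation -/

theorem mainTheorem4 {w : ℕ} (hw : 0 < w) (k : Composition w) :
    (∀ α : ℂ, α.re < 1 →
      IntegrableOn (HurwitzMZV.integrand k.blocksFun α) (Set.Ioo (0 : ℝ) 1) ∧
      ∫ x in Set.Ioo (0 : ℝ) 1, HurwitzMZV.integrand k.blocksFun α x =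
        (-1 : ℂ) ^ k.length * HurwitzMZV.zetaStar
          (HurwitzMZV.plusFirst (HurwitzMZV.hoffmanDual k.reverse).blocksFun) (1 - α)) ∧
    ∃ I : ℂ → ℂ, DifferentiableOn ℂ I HurwitzMZV.complexMinusPosInt ∧
      (∀ α : ℂ, α.re < 1 →
        I α = ∫ x in Set.Ioo (0 : ℝ) 1, HurwitzMZV.integrand k.blocksFun α x) ∧
      ∀ α ∈ HurwitzMZV.complexMinusPosInt,
        Tendsto
          (HurwitzMZV.zetaStarSum
            (HurwitzMZV.plusFirst (HurwitzMZV.hoffmanDual k.reverse).blocksFun) (1 - α))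
          atTop
          (𝓝 (HurwitzMZV.zetaStar
            (HurwitzMZV.plusFirst (HurwitzMZV.hoffmanDual k.reverse).blocksFun) (1 - α))) ∧
        I α = (-1 : ℂ) ^ k.length * HurwitzMZV.zetaStar
          (HurwitzMZV.plusFirst (HurwitzMZV.hoffmanDual k.reverse).blocksFun) (1 - α) := by
  open HurwitzMZV in
  set m := plusFirst (hoffmanDual k.reverse).blocksFun with hm
  have hlist := plusFirst_hoffmanDual_reverse hw k
  have hne : k.blocks ≠ [] := by
    intro h
    have := k.blocks_sum
    rw [h, List.sum_nil] at this
    omega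
  set b := wordOf k.blocks with hb
  have hadm : Admissible b := admissible_wordOf _
  have hbne : b ≠ [] := wordOf_ne_nil hne
  obtain ⟨b', hb'⟩ := exists_wordOf_eq_append hne
  -- The innermost letter is `true`, so the block of the largest index holds that letter's factor
  -- and the one from the empty word.
  have htwo : 2 ≤ (b.foldl dualStep (0, [])).1 + 1 := by
    rw [hb, hb', List.foldl_concat, dualStep, if_pos rfl]
    omega
  obtain ⟨J, hJd, hJ⟩ := exists_differentiableOn_tendsto_starList htwo
    (foldl_dualStep_spec b).2.1
  have hsum : ∀ α, zetaStarSum m (1 - α) = starList α (((b.foldl dualStep (0, [])).1 + 1) ::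
      (b.foldl dualStep (0, [])).2) := by
    intro α
    funext N
    rw [zetaStarSum_eq_starList, hm, hlist]
  have hJ' : ∀ α ∈ complexMinusPosInt, Tendsto (zetaStarSum m (1 - α)) atTop (𝓝 (J α)) := by
    intro α hα
    rw [hsum]
    exact hJ α hα
  have hzeta : ∀ α ∈ complexMinusPosInt, zetaStar m (1 - α) = J α := fun α hα =>
    (hJ' α hα).limUnder_eq
  have hmem : ∀ α : ℂ, α.re < 1 → α ∈ complexMinusPosInt := by
    rintro α hα n hn rfl
    have : (1 : ℝ) ≤ n := by exact_mod_cast hn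
    rw [Complex.natCast_re] at hα
    linarith
  have hint : ∀ α : ℂ, Set.EqOn (integrand k.blocksFun α)
      (fun x => (-1 : ℂ) ^ k.length * (mellinFun b (1 - α) x / x)) (Set.Ioo 0 1) := by
    intro α x hx
    have h1 : ((1 - x : ℝ) : ℂ) ≠ 0 := Complex.ofReal_ne_zero.2 (by linarith [hx.2])
    dsimp only
    rw [integrand, Li_div_sub_one (k.length_pos_of_pos hw) k.blocksFun (fun i => k.one_le_blocksFun i) hx,
      k.ofFn_blocksFun, mellinFun, ← hb, show (1 - α - 1 : ℂ) = -α by ring, Complex.cpow_neg]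
    push_cast
    field_simp
  have hval : ∀ α : ℂ, α.re < 1 →
      ∫ x in Set.Ioo (0 : ℝ) 1, integrand k.blocksFun α x = (-1 : ℂ) ^ k.length * J α := by
    intro α hα
    rw [setIntegral_congr_fun measurableSet_Ioo (hint α), integral_const_mul]
    congr 1
    -- The same finite sums converge to the integral by the Mellin recursion and to J α by local
    -- uniform convergence.
    refine tendsto_nhds_unique (tendsto_sum_truncSum hα hadm hbne) ((hJ α (hmem α hα)).congr ?_)
    intro N
    rw [← sum_truncSum_eq α N b (0, [])]
    refine Finset.sum_congr rfl fun j _ => ?_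
    simp [starList]
  refine ⟨fun α hα => ⟨?_, ?_⟩, fun α => (-1 : ℂ) ^ k.length * J α, hJd.const_mul _,
    fun α hα => (hval α hα).symm, fun α hα => ⟨?_, ?_⟩⟩
  · rw [integrableOn_congr_fun (hint α) measurableSet_Ioo]
    exact (integrableOn_mellinFun_div hadm hbne (by simpa using hα)).const_mul _
  · rw [hval α hα, hzeta α (hmem α hα)]
  · rw [hzeta α hα]
    exact hJ' α hα
  · rw [hzeta α hα]
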